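/- **Setting.** Let $\mathcal M=(\mathcal S,\mathcal A,P,r,\gamma)$ be a tabular discounted Markov decision process: a finite nonempty set $\mathcal S$ of states, finite nonempty action sets $\mathcal A_s$, the set $\mathcal A=\{(s,a):s\in\mathcal S,\ a\in\mathcal A_s\}$ with $A_{\rm tot}=|\mathcal A|$, rewards $r_a(s)\in[0,1]$, transition distributions $p_a(s)$ on $\mathcal S$ (the rows of $P\in[0,1]^{\mathcal A\times\mathcal S}$), and $\gamma\in[0,1)$. A policy is a map $\pi$ with $\pi(s)\in\mathcal A_s$; $v^\star(s)$ is the maximum over all policies of the expected discounted reward $\mathbb E[\sum_{t\ge0}\gamma^t r_t]$ from $s$; a policy $\pi^\star$ is optimal if it attains $v^\star(s)$ for every $s$; $P^\star$ is the $\mathcal S\times\mathcal S$ matrix with rows $p_{\pi^\star(s)}(s)^\top$; and $\mathcal T_\pi(u)(s)=r_{\pi(s)}(s)+\gamma\,p_{\pi(s)}(s)^\top u$. A generative model returns, for each query $(s,a)\in\mathcal A$, an independent sample of $p_a(s)$. Inequalities between vectors are entrywise, and $\mathbf 1$ is the all-ones vector. **Algorithm.** $\mathrm{TruncatedVRVI}(v^{(0)},\pi^{(0)},x,\alpha,\delta)$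 sets $L=\lceil \log(8)(1-\gamma)^{-1}\rceil$, $M=\lceil L\cdot 2^8\log(2A_{\rm tot}/\delta)\rceil$ and $g^{(1)}=\hat g^{(1)}=0\in\mathbb R^{\mathcal A}$. For $\ell=1,\dots,L$ it computes $\tilde Q=r+\gamma(x+\hat g^{(\ell)})$ and, for each state $s$, $\tilde v^{(\ell)}(s)=\min\{\max_{a\in\mathcal A_s}\tilde Q_{s,a},\ v^{(\ell-1)}(s)+(1-\gamma)\alpha\}$ and $\tilde\pi^{(\ell)}(s)\in\arg\max_{a\in\mathcal A_s}\tilde Q_{s,a}$ (any fixed rule selecting a maximizer from the values $(\tilde Q_{s,a})_{a\in\mathcal A_s}$). It sets $(v^{(\ell)}(s),\pi^{(\ell)}(s))$ to $(\tilde v^{(\ell)}(s),\tilde\pi^{(\ell)}(s))$ if $\tilde v^{(\ell)}(s)\ge v^{(\ell-1)}(s)$, and to $(v^{(\ell-1)}(s),\pi^{(\ell-1)}(s))$ otherwise. For each $(s,a)$ it then draws $M$ fresh independent samples $i_1,\dots,i_M$ from $p_a(s)$ and sets $g^{(\ell+1)}_a(s)=g^{(\ell)}_a(s)+\frac1M\sum_{n=1}^M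 (v^{(\ell)}-v^{(\ell-1)})(i_n)$ and $\hat g^{(\ell+1)}_a(s)=g^{(\ell+1)}_a(s)-\frac{(1-\gamma)\alpha}{8}$. It returns $(v^{(L)},\pi^{(L)})$. **Statement.** (i) Let $\delta\in(0,1)$, $\alpha\ge 0$ and $\beta\in\mathbb R^{\mathcal A}_{\ge0}$. Suppose that $Pv^{(0)}-\beta\le x\le Pv^{(0)}$, that $v^\star-\alpha\mathbf 1\le v^{(0)}\le v^\star$, and that $v^{(0)}\le\mathcal T_{\pi^{(0)}}(v^{(0)})$. Then, with probability at least $1-\delta$, the output $(v^{(L)},\pi^{(L)})$ of $\mathrm{TruncatedVRVI}(v^{(0)},\pi^{(0)},x,\alpha,\delta)$ satisfies $$0\le v^\star-v^{(L)}\le\gamma^L\alpha\,\mathbf 1+(I-\gamma P^\star)^{-1}\xi,\qquad \xi(s)=\gamma\Big(\frac{1-\gamma}{4}\alpha+\beta_{\pi^\star(s)}(s)\Big),$$ for every optimal policy $\pi^\star$, and $v^{(L)}\le\mathcal T_{\pi^{(L)}}(v^{(L)})$; and if $\beta=0$, then moreover $0\le v^\star-v^{(L)}\le\frac{\alpha}{2}\mathbf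 1$. (ii) The algorithm can be implemented with $A_{\rm tot}ML$ queries, $O(A_{\rm tot}ML)$ time and $O(A_{\rm tot})$ space. Precisely, there are an absolute constant $C$ and a single program for a real RAM with generative-model access (unit cost for the four arithmetic operations, $\log$ and comparisons on reals, for setting to constants, copying, incrementing and comparing indices, and for a query; $P$ is not part of the input) such that for every $\mathcal M$, for some rule of selecting maximizers, on all inputs with $\alpha\ge0$ and $\delta\in(0,1)$ and for all answers of the generative model the program halts, outputs exactly the result of $\mathrm{TruncatedVRVI}$ on these answers, makes at most $A_{\rm tot}ML$ queries, takes at most $C\,A_{\rm tot}ML$ steps, and accesses at most $C\,A_{\rm tot}$ memory cells. -/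

import Mathlib

open MeasureTheory ProbabilityTheory

noncomputable section

/-! Tabular discounted Markov decision processes -/

/-- A tabular discounted Markov decision process: finitely many states `0, …, numStates - 1`, at
state `s` the nonempty set of actions `0, …, numActions s - 1`, rewards in `[0,1]`, transition
distributions `trans s a` on the states, and a discount factor in `[0,1)`. -/
structure DMDP where
  numStates : ℕ
  numStates_pos : 0 < numStates
  numActions : Fin numStates → ℕ
  numActions_pos : ∀ s, 0 < numActions s
  reward : (s : Fin numStates) → Fin (numActions s) → ℝ
  reward_nonneg : ∀ s a, 0 ≤ reward s a
  reward_le_one : ∀ s a, reward s a ≤ 1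
  trans : (s : Fin numStates) → Fin (numActions s) → Fin numStates → ℝ
  trans_nonneg : ∀ s a t, 0 ≤ trans s a t
  trans_sum : ∀ s a, ∑ t, trans s a t = 1
  γ : ℝ
  γ_nonneg : 0 ≤ γ
  γ_lt_one : γ < 1

/-- `x` is an `α`-underestimate of `y`. -/
def IsUnderestimate {ι : Type*} (α : ℝ) (x y : ι → ℝ) : Prop :=
  0 ≤ α ∧ ∀ i, y i - α ≤ x i ∧ x i ≤ y i

namespace DMDP

variable (𝓜 : DMDP)

abbrev State : Type := Fin 𝓜.numStates

abbrev Action (s : 𝓜.State) : Type := Fin (𝓜.numActions s)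

/-- State-action pairs. -/
abbrev Pair : Type := (s : 𝓜.State) × 𝓜.Action s

/-- The number of state-action pairs. -/
def Atot : ℕ := ∑ s, 𝓜.numActions s

/-- Deterministic policies. -/
abbrev Policy : Type := (s : 𝓜.State) → 𝓜.Action s

/-- The vector `P u`, indexed by state-action pairs. -/
def utility (u : 𝓜.State → ℝ) (p : 𝓜.Pair) : ℝ := ∑ t, 𝓜.trans p.1 p.2 t * u t

/-- The value operator of the policy `π`. -/
def policyOp (π : 𝓜.Policy) (u : 𝓜.State → ℝ) (s : 𝓜.State) : ℝ :=
  𝓜.reward s (π s) + 𝓜.γ * 𝓜.utility u ⟨s, π s⟩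

/-- The transition matrix of the Markov chain of states under the policy `π`. -/
def policyMatrix (π : 𝓜.Policy) : Matrix 𝓜.State 𝓜.State ℝ :=
  Matrix.of fun s t => 𝓜.trans s (π s) t

/-- The expected discounted reward `E[∑ₜ γᵗ rₜ]` of the policy `π` started in `s`. The law of the
state at time `t` is the row `s` of the `t`-th power of the transition matrix, so that
`E[rₜ] = ((P^π)^t r^π)(s)`. -/
def policyValue (π : 𝓜.Policy) (s : 𝓜.State) : ℝ :=
  ∑' t : ℕ, 𝓜.γ ^ t * ((𝓜.policyMatrix π ^ t).mulVec fun u => 𝓜.reward u (π u)) s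

/-- The optimal value `v*`: the largest expected discounted reward of any policy. -/
def optimalValue (s : 𝓜.State) : ℝ := ⨆ π : 𝓜.Policy, 𝓜.policyValue π s

/-- `π` is an optimal policy: it attains the optimal value from every state. -/
def IsOptimalPolicy (π : 𝓜.Policy) : Prop := ∀ s, 𝓜.policyValue π s = 𝓜.optimalValue s

/-! The generative model and the algorithm -/

/-- The answers of a generative model: `ω p j` is the answer to the `j`-th query (from `j = 0`)
of the state-action pair `p`. -/
abbrev Tape : Type := 𝓜.Pair → ℕ → 𝓜.State

/-- The random answers `X` are mutually independent, each answer to a query of `(s, a)` being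
distributed according to the transition distribution of `(s, a)`. -/
structure IsGenerativeModel {Ω : Type*} [MeasurableSpace Ω] (μ : Measure Ω)
    (X : 𝓜.Pair → ℕ → Ω → 𝓜.State) : Prop where
  measurable : ∀ p j, Measurable (X p j)
  law : ∀ p j t, μ.real {ω | X p j ω = t} = 𝓜.trans p.1 p.2 t
  indep : iIndepFun (fun (q : 𝓜.Pair × ℕ) => X q.1 q.2) μ

/-- The estimate of `pᵀ u` from the `M` draws `i 0, …, i (M - 1)`, shifted down according to the
offset parameter `η`. The norm is the sup norm. -/
def sample (u : 𝓜.State → ℝ) (M : ℕ) (η : ℝ) (i : ℕ → 𝓜.State) : ℝ :=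
  let x := (1 / (M : ℝ)) * ∑ j ∈ Finset.range M, u (i j)
  let σ := (1 / (M : ℝ)) * (∑ j ∈ Finset.range M, u (i j) ^ 2) - x ^ 2
  x - Real.sqrt (2 * η * σ) - 4 * η ^ ((3 : ℝ) / 4) * ‖u‖ - (2 / 3) * η * ‖u‖

/-- `sample` for every state-action pair, with the draws `i p` for the pair `p`. -/
def apxUtility (u : 𝓜.State → ℝ) (M : ℕ) (η : ℝ) (i : 𝓜.Tape) (p : 𝓜.Pair) : ℝ :=
  𝓜.sample u M η (i p)

/-- A rule selecting, at every state, an action from given action values. -/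
abbrev SelectionRule : Type := (s : 𝓜.State) → (𝓜.Action s → ℝ) → 𝓜.Action s

/-- The rule always selects a maximizing action (with some way of breaking ties). -/
def IsArgmaxRule (am : 𝓜.SelectionRule) : Prop :=
  ∀ (s : 𝓜.State) (f : 𝓜.Action s → ℝ) (a : 𝓜.Action s), f a ≤ f (am s f)

/-- The number of iterations. -/
def iterCount : ℕ := ⌈Real.log 8 * (1 - 𝓜.γ)⁻¹⌉₊

/-- The number of samples per state-action pair and iteration. -/
def sampleCount (δ : ℝ) : ℕ :=
  ⌈(𝓜.iterCount : ℝ) * 2 ^ 8 * Real.log (2 * (𝓜.Atot : ℝ) / δ)⌉₊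

/-- The variables of `TruncatedVRVI` that survive from one iteration to the next. -/
structure Iterate where
  v : 𝓜.State → ℝ
  π : 𝓜.Policy
  g : 𝓜.Pair → ℝ
  gHat : 𝓜.Pair → ℝ

/-- One iteration of `TruncatedVRVI`. The iterations are numbered from `0`, and iteration `ℓ`
uses the draws `ℓ M, …, ℓ M + M - 1` of every state-action pair. -/
def iteration (am : 𝓜.SelectionRule) (x : 𝓜.Pair → ℝ) (α : ℝ) (M : ℕ) (ω : 𝓜.Tape)
    (ℓ : ℕ) (I : 𝓜.Iterate) : 𝓜.Iterate :=
  let Q : 𝓜.Pair → ℝ := fun p => 𝓜.reward p.1 p.2 + 𝓜.γ * (x p + I.gHat p)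
  let vTilde : 𝓜.State → ℝ := fun s =>
    min (⨆ a : 𝓜.Action s, Q ⟨s, a⟩) (I.v s + (1 - 𝓜.γ) * α)
  let πTilde : 𝓜.Policy := fun s => am s fun a => Q ⟨s, a⟩
  let v' : 𝓜.State → ℝ := fun s => if vTilde s ≥ I.v s then vTilde s else I.v s
  let π' : 𝓜.Policy := fun s => if vTilde s ≥ I.v s then πTilde s else I.π s
  let Δ : 𝓜.Pair → ℝ := 𝓜.apxUtility (v' - I.v) M 0 fun p j => ω p (ℓ * M + j)
  let g' : 𝓜.Pair → ℝ := I.g + Δ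
  { v := v', π := π', g := g', gHat := fun p => g' p - (1 - 𝓜.γ) * α / 8 }

/-- The state of `TruncatedVRVI` after `ℓ` iterations. -/
def iterates (am : 𝓜.SelectionRule) (v₀ : 𝓜.State → ℝ) (π₀ : 𝓜.Policy) (x : 𝓜.Pair → ℝ)
    (α : ℝ) (M : ℕ) (ω : 𝓜.Tape) : ℕ → 𝓜.Iterate
  | 0 => { v := v₀, π := π₀, g := 0, gHat := 0 }
  | ℓ + 1 => 𝓜.iteration am x α M ω ℓ (iterates am v₀ π₀ x α M ω ℓ)

/-- The algorithm `TruncatedVRVI`, returning a value vector and a policy. -/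
def truncatedVRVI (am : 𝓜.SelectionRule) (v₀ : 𝓜.State → ℝ) (π₀ : 𝓜.Policy)
    (x : 𝓜.Pair → ℝ) (α δ : ℝ) (ω : 𝓜.Tape) : (𝓜.State → ℝ) × 𝓜.Policy :=
  let I := 𝓜.iterates am v₀ π₀ x α (𝓜.sampleCount δ) ω 𝓜.iterCount
  (I.v, I.π)

end DMDP

/-! A real RAM with access to a generative model.

The memory consists of arrays of natural numbers (indices) and arrays of reals; the arrays are
numbered. Natural numbers can only be set to constants, copied, incremented and compared, so that
along a run they stay bounded by inputs, constants of the program, oracle answers and the running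
time. Reals are subject to the four arithmetic operations, the logarithm and comparison. -/

namespace RealRAM

/-- Memory cells: the position `i` of the index array or real array number `a`. -/
inductive Cell where
  | idx (a i : ℕ)
  | real (a i : ℕ)
deriving DecidableEq

/-- References in programs: `scalar a` is the position `0` of the array `a`, and `entry a i` is
the position of the array `a` that is stored in the scalar index variable `i`. -/
inductive Ref where
  | scalar (a : ℕ)
  | entry (a i : ℕ)

inductive ROp where
  | add
  | sub
  | mul
  | div

/-- Elementary instructions; the first reference is the destination. The instruction
`query d s a` queries the generative model with the state and action that are stored in `s` and
`a`, and stores the answer in `d`. -/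
inductive Instr where
  | iConst (d : Ref) (c : ℕ)
  | iCopy (d s : Ref)
  | iSucc (d : Ref)
  | rConst (d : Ref) (c : ℕ)
  | rCopy (d s : Ref)
  | rOp (o : ROp) (d s t : Ref)
  | rLog (d s : Ref)
  | query (d s a : Ref)

/-- Strict comparisons of two index cells or of two real cells. -/
inductive Test where
  | iLt (s t : Ref)
  | rLt (s t : Ref)

/-- Programs. -/
inductive Prog where
  | instr (c : Instr)
  | seq (p q : Prog)
  | cond (b : Test) (p q : Prog)
  | loop (b : Test) (p : Prog)

/-- Configurations: the memory, how often each state-action pair has been queried, and the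
resources used so far (number of steps, number of queries, set of memory cells accessed). -/
structure Config where
  idx : ℕ → ℕ → ℕ
  real : ℕ → ℕ → ℝ
  asked : ℕ → ℕ → ℕ
  time : ℕ
  queries : ℕ
  touched : Finset Cell

/-- The position that a reference denotes, within its array. -/
def Ref.pos (σ : Config) : Ref → ℕ
  | .scalar _ => 0
  | .entry _ i => σ.idx i 0

def Ref.arr : Ref → ℕ
  | .scalar a => a
  | .entry a _ => a

/-- The index cells that are read in order to find the position. -/
def Ref.aux : Ref → Finset Cell
  | .scalar _ => ∅
  | .entry _ i => {Cell.idx i 0}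

/-- The cells accessed through a reference to an index. -/
def Ref.iCells (σ : Config) (r : Ref) : Finset Cell := insert (Cell.idx r.arr (r.pos σ)) r.aux

/-- The cells accessed through a reference to a real. -/
def Ref.rCells (σ : Config) (r : Ref) : Finset Cell := insert (Cell.real r.arr (r.pos σ)) r.aux

def Ref.iVal (σ : Config) (r : Ref) : ℕ := σ.idx r.arr (r.pos σ)

def Ref.rVal (σ : Config) (r : Ref) : ℝ := σ.real r.arr (r.pos σ)

def ROp.eval : ROp → ℝ → ℝ → ℝ
  | .add, x, y => x + y
  | .sub, x, y => x - y
  | .mul, x, y => x * y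
  | .div, x, y => x / y

/-- Replace one value of a doubly indexed family. -/
def update₂ {β : Type} (f : ℕ → ℕ → β) (a i : ℕ) (y : β) : ℕ → ℕ → β :=
  Function.update f a (Function.update (f a) i y)

def Config.setIdx (σ : Config) (d : Ref) (y : ℕ) : Config :=
  { σ with idx := update₂ σ.idx d.arr (d.pos σ) y }

def Config.setReal (σ : Config) (d : Ref) (y : ℝ) : Config :=
  { σ with real := update₂ σ.real d.arr (d.pos σ) y }

/-- Charge one step and the access to the given cells. -/
def Config.charge (σ : Config) (cells : Finset Cell) : Config :=
  { σ with time := σ.time + 1, touched := σ.touched ∪ cells }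

/-- The cells accessed by an instruction. -/
def Instr.cells (σ : Config) : Instr → Finset Cell
  | .iConst d _ => d.iCells σ
  | .iCopy d s => d.iCells σ ∪ s.iCells σ
  | .iSucc d => d.iCells σ
  | .rConst d _ => d.rCells σ
  | .rCopy d s => d.rCells σ ∪ s.rCells σ
  | .rOp _ d s t => d.rCells σ ∪ s.rCells σ ∪ t.rCells σ
  | .rLog d s => d.rCells σ ∪ s.rCells σ
  | .query d s a => d.iCells σ ∪ s.iCells σ ∪ a.iCells σ

/-- The effect of an instruction, apart from the charge. The answer to the `j`-th query of the
state `s` and action `a` is `O s a j`. -/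
def Instr.effect (O : ℕ → ℕ → ℕ → ℕ) (σ : Config) : Instr → Config
  | .iConst d c => σ.setIdx d c
  | .iCopy d s => σ.setIdx d (s.iVal σ)
  | .iSucc d => σ.setIdx d (d.iVal σ + 1)
  | .rConst d c => σ.setReal d (c : ℝ)
  | .rCopy d s => σ.setReal d (s.rVal σ)
  | .rOp o d s t => σ.setReal d (o.eval (s.rVal σ) (t.rVal σ))
  | .rLog d s => σ.setReal d (Real.log (s.rVal σ))
  | .query d s a =>
    { σ.setIdx d (O (s.iVal σ) (a.iVal σ) (σ.asked (s.iVal σ) (a.iVal σ))) with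
      asked := update₂ σ.asked (s.iVal σ) (a.iVal σ) (σ.asked (s.iVal σ) (a.iVal σ) + 1)
      queries := σ.queries + 1 }

def Instr.step (O : ℕ → ℕ → ℕ → ℕ) (σ : Config) (c : Instr) : Config :=
  (c.effect O σ).charge (c.cells σ)

def Test.holds (σ : Config) : Test → Prop
  | .iLt s t => s.iVal σ < t.iVal σ
  | .rLt s t => s.rVal σ < t.rVal σ

def Test.cells (σ : Config) : Test → Finset Cell
  | .iLt s t => s.iCells σ ∪ t.iCells σ
  | .rLt s t => s.rCells σ ∪ t.rCells σ

/-- `Exec O p σ σ'`: with the oracle answers `O`, the program `p` started in `σ` halts in `σ'`.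
Every instruction and every evaluation of a test takes one step. -/
inductive Exec (O : ℕ → ℕ → ℕ → ℕ) : Prog → Config → Config → Prop where
  | instr (c : Instr) (σ : Config) : Exec O (.instr c) σ (c.step O σ)
  | seq {p q : Prog} {σ σ₁ σ₂ : Config} :
      Exec O p σ σ₁ → Exec O q σ₁ σ₂ → Exec O (.seq p q) σ σ₂
  | cond_true {b : Test} {p q : Prog} {σ σ₁ : Config} :
      b.holds σ → Exec O p (σ.charge (b.cells σ)) σ₁ → Exec O (.cond b p q) σ σ₁
  | cond_false {b : Test} {p q : Prog} {σ σ₁ : Config} :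
      ¬ b.holds σ → Exec O q (σ.charge (b.cells σ)) σ₁ → Exec O (.cond b p q) σ σ₁
  | loop_true {b : Test} {p : Prog} {σ σ₁ σ₂ : Config} :
      b.holds σ → Exec O p (σ.charge (b.cells σ)) σ₁ → Exec O (.loop b p) σ₁ σ₂ →
        Exec O (.loop b p) σ σ₂
  | loop_false {b : Test} {p : Prog} {σ : Config} :
      ¬ b.holds σ → Exec O (.loop b p) σ (σ.charge (b.cells σ))

end RealRAM

namespace DMDP

variable (𝓜 : DMDP)

/-- The oracle of the machine that answers queries according to `ω` (and queries of things that
are not state-action pairs by `0`). -/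
def oracle (ω : 𝓜.Tape) (s a j : ℕ) : ℕ :=
  if h : ∃ hs : s < 𝓜.numStates, a < 𝓜.numActions ⟨s, hs⟩ then
    (ω ⟨⟨s, h.1⟩, ⟨a, h.2⟩⟩ j : ℕ)
  else 0

/-- The array of length `k` with entries `f`, followed by zeros. -/
def toArray {β : Type} [Zero β] {k : ℕ} (f : Fin k → β) (i : ℕ) : β :=
  if h : i < k then f ⟨i, h⟩ else 0

/-- A vector indexed by the state-action pairs as an array: the pairs are listed state by state,
so that `(s, a)` is at position `(∑ s' < s, numActions s') + a`. -/
def pairArray (f : 𝓜.Pair → ℝ) : ℕ → ℝ :=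
  toArray fun j : Fin (∑ s, 𝓜.numActions s) => f (finSigmaFinEquiv.symm j)

/-- The start configuration of the machine for the inputs of `TruncatedVRVI`: the index arrays
`0`, `1`, `2` hold the number of states, the numbers of actions, and `π₀`; the real arrays
`0`, …, `5` hold `γ`, `α`, `δ`, `v₀`, the rewards, and `x`. The transition distributions are not
part of the input. -/
def startConfig (v₀ : 𝓜.State → ℝ) (π₀ : 𝓜.Policy) (x : 𝓜.Pair → ℝ) (α δ : ℝ) :
    RealRAM.Config where
  idx
    | 0 => fun i => if i = 0 then 𝓜.numStates else 0
    | 1 => toArray 𝓜.numActions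
    | 2 => toArray fun s => (π₀ s : ℕ)
    | _ => fun _ => 0
  real
    | 0 => fun i => if i = 0 then 𝓜.γ else 0
    | 1 => fun i => if i = 0 then α else 0
    | 2 => fun i => if i = 0 then δ else 0
    | 3 => toArray v₀
    | 4 => 𝓜.pairArray fun p => 𝓜.reward p.1 p.2
    | 5 => 𝓜.pairArray x
    | _ => fun _ => 0
  asked := fun _ _ => 0
  time := 0
  queries := 0
  touched := ∅

/-- The machine's output: the real array `3` holds `v` and the index array `2` holds `π`. -/
def IsOutput (σ : RealRAM.Config) (v : 𝓜.State → ℝ) (π : 𝓜.Policy) : Prop :=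
  ∀ s : 𝓜.State, σ.real 3 s = v s ∧ σ.idx 2 s = π s

end DMDP

end

/-!
Truncation and the comparison with the previous value keep `v ≤ v⋆` and `v ≤ T_π v` along all
iterations, provided that the estimates never exceed the expected utilities. The errors of the
running sums of sample means form a martingale whose increments are averages of independent samples
from `[0, (1 - γ) α]`, minus their mean. Hoeffding's lemma bounds the expectation of its
exponential, which is a submartingale, and Doob's maximal inequality then bounds the errors of all
iterations simultaneously, so that a union bound is needed over the pairs only. With errors at most
`(1 - γ) α / 8`, each iteration contracts the distance to `v⋆` by `γ` up to `ξ`, which sums to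
`(1 - γ P⋆)⁻¹ ξ`.
-/

noncomputable section

/-! ### Discounted values -/

namespace DMDP

variable (𝓜 : DMDP)

instance : Nonempty 𝓜.State := ⟨⟨0, 𝓜.numStates_pos⟩⟩

instance (s : 𝓜.State) : Nonempty (𝓜.Action s) := ⟨⟨0, 𝓜.numActions_pos s⟩⟩

lemma utility_mono {u w : 𝓜.State → ℝ} (h : ∀ s, u s ≤ w s) (p : 𝓜.Pair) :
    𝓜.utility u p ≤ 𝓜.utility w p :=
  Finset.sum_le_sum fun t _ => mul_le_mul_of_nonneg_left (h t) (𝓜.trans_nonneg _ _ _)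

lemma utility_sub (u w : 𝓜.State → ℝ) (p : 𝓜.Pair) :
    𝓜.utility (u - w) p = 𝓜.utility u p - 𝓜.utility w p := by
  simp [utility, mul_sub, Finset.sum_sub_distrib]

lemma utility_add (u w : 𝓜.State → ℝ) (p : 𝓜.Pair) :
    𝓜.utility (u + w) p = 𝓜.utility u p + 𝓜.utility w p := by
  simp [utility, mul_add, Finset.sum_add_distrib]

lemma utility_const (c : ℝ) (p : 𝓜.Pair) : 𝓜.utility (fun _ => c) p = c := by
  simp [utility, ← Finset.sum_mul, 𝓜.trans_sum]

lemma utility_mem_Icc {u : 𝓜.State → ℝ} {c d : ℝ} (h : ∀ s, u s ∈ Set.Icc c d) (p : 𝓜.Pair) :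
    𝓜.utility u p ∈ Set.Icc c d :=
  ⟨by simpa only [utility_const] using 𝓜.utility_mono (u := fun _ => c) (fun s => (h s).1) p,
    by simpa only [utility_const] using 𝓜.utility_mono (w := fun _ => d) (fun s => (h s).2) p⟩

lemma discounted_mono {u w : 𝓜.State → ℝ} (h : ∀ s, u s ≤ w s) (p : 𝓜.Pair) :
    𝓜.γ * 𝓜.utility u p ≤ 𝓜.γ * 𝓜.utility w p :=
  mul_le_mul_of_nonneg_left (𝓜.utility_mono h p) 𝓜.γ_nonneg

lemma one_sub_γ_pos : 0 < 1 - 𝓜.γ := sub_pos.2 𝓜.γ_lt_one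

section Comparison

variable {𝓜} {π : 𝓜.Policy} {u w ξ : 𝓜.State → ℝ}

lemma subsolution_le_supersolution (hu : ∀ s, u s ≤ ξ s + 𝓜.γ * 𝓜.utility u ⟨s, π s⟩)
    (hw : ∀ s, ξ s + 𝓜.γ * 𝓜.utility w ⟨s, π s⟩ ≤ w s) (s : 𝓜.State) : u s ≤ w s := by
  obtain ⟨m, hm⟩ := Finite.exists_max (u - w)
  have h_disc : 𝓜.γ * 𝓜.utility (u - w) ⟨m, π m⟩ ≤ 𝓜.γ * (u - w) m := by
    simpa only [utility_const] using 𝓜.discounted_mono hm ⟨m, π m⟩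
  have h_diff : (u - w) m ≤ 𝓜.γ * 𝓜.utility (u - w) ⟨m, π m⟩ := by
    rw [utility_sub, Pi.sub_apply]
    linarith [hu m, hw m]
  have h_max : (u - w) m ≤ 0 := by nlinarith [𝓜.one_sub_γ_pos]
  exact sub_nonpos.1 ((hm s).trans h_max)

end Comparison

lemma policyMatrix_mulVec (π : 𝓜.Policy) (u : 𝓜.State → ℝ) (s : 𝓜.State) :
    (𝓜.policyMatrix π).mulVec u s = 𝓜.utility u ⟨s, π s⟩ := rfl

/-- The expected reward at time `t` of the policy `π` started in `s`. -/
def expectedReward (π : 𝓜.Policy) (t : ℕ) : 𝓜.State → ℝ :=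
  (𝓜.policyMatrix π ^ t).mulVec fun u => 𝓜.reward u (π u)

lemma expectedReward_zero (π : 𝓜.Policy) (s : 𝓜.State) :
    𝓜.expectedReward π 0 s = 𝓜.reward s (π s) := by
  simp [expectedReward]

lemma expectedReward_succ (π : 𝓜.Policy) (t : ℕ) (s : 𝓜.State) :
    𝓜.expectedReward π (t + 1) s = 𝓜.utility (𝓜.expectedReward π t) ⟨s, π s⟩ := by
  rw [expectedReward, pow_succ', ← Matrix.mulVec_mulVec, policyMatrix_mulVec]
  rfl

lemma expectedReward_mem_Icc (π : 𝓜.Policy) (t : ℕ) (s : 𝓜.State) :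
    𝓜.expectedReward π t s ∈ Set.Icc 0 1 := by
  induction t generalizing s with
  | zero =>
    rw [expectedReward_zero]
    exact ⟨𝓜.reward_nonneg _ _, 𝓜.reward_le_one _ _⟩
  | succ t ih =>
    rw [expectedReward_succ]
    exact 𝓜.utility_mem_Icc ih _

lemma summable_discounted_expectedReward (π : 𝓜.Policy) (s : 𝓜.State) :
    Summable fun t : ℕ => 𝓜.γ ^ t * 𝓜.expectedReward π t s :=
  Summable.of_nonneg_of_le
    (fun t => mul_nonneg (pow_nonneg 𝓜.γ_nonneg t) (𝓜.expectedReward_mem_Icc π t s).1)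
    (fun t => mul_le_of_le_one_right (pow_nonneg 𝓜.γ_nonneg t) (𝓜.expectedReward_mem_Icc π t s).2)
    (summable_geometric_of_lt_one 𝓜.γ_nonneg 𝓜.γ_lt_one)

lemma policyValue_eq_policyOp (π : 𝓜.Policy) (s : 𝓜.State) :
    𝓜.policyValue π s = 𝓜.policyOp π (𝓜.policyValue π) s :=
  calc 𝓜.policyValue π s = ∑' t, 𝓜.γ ^ t * 𝓜.expectedReward π t s := rfl
    _ = 𝓜.reward s (π s) + ∑' t, 𝓜.γ ^ (t + 1) * 𝓜.expectedReward π (t + 1) s := by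
      rw [(𝓜.summable_discounted_expectedReward π s).tsum_eq_zero_add, pow_zero, one_mul,
        expectedReward_zero]
    _ = 𝓜.reward s (π s) +
          𝓜.γ * ∑' t, ∑ u, 𝓜.trans s (π s) u * (𝓜.γ ^ t * 𝓜.expectedReward π t u) := by
      simp only [expectedReward_succ, utility, ← tsum_mul_left, Finset.mul_sum]
      refine congrArg _ (tsum_congr fun t => Finset.sum_congr rfl fun u _ => ?_)
      ring
    _ = 𝓜.policyOp π (𝓜.policyValue π) s := by
      rw [Summable.tsum_finsetSum fun u _ =>
        (𝓜.summable_discounted_expectedReward π u).mul_left _]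
      simp only [tsum_mul_left]
      rfl

variable {𝓜} in
lemma le_policyValue {π : 𝓜.Policy} {u : 𝓜.State → ℝ} (h : ∀ s, u s ≤ 𝓜.policyOp π u s)
    (s : 𝓜.State) : u s ≤ 𝓜.policyValue π s :=
  subsolution_le_supersolution h (fun s => (𝓜.policyValue_eq_policyOp π s).ge) s

variable {𝓜} in
lemma policyValue_le {π : 𝓜.Policy} {u : 𝓜.State → ℝ} (h : ∀ s, 𝓜.policyOp π u s ≤ u s)
    (s : 𝓜.State) : 𝓜.policyValue π s ≤ u s :=
  subsolution_le_supersolution (fun s => (𝓜.policyValue_eq_policyOp π s).le) h s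

lemma policyValue_le_optimalValue (π : 𝓜.Policy) (s : 𝓜.State) :
    𝓜.policyValue π s ≤ 𝓜.optimalValue s :=
  le_ciSup (f := fun π : 𝓜.Policy => 𝓜.policyValue π s) (Set.finite_range _).bddAbove π

variable {𝓜} in
lemma le_optimalValue {π : 𝓜.Policy} {u : 𝓜.State → ℝ} (h : ∀ s, u s ≤ 𝓜.policyOp π u s)
    (s : 𝓜.State) : u s ≤ 𝓜.optimalValue s :=
  (le_policyValue h s).trans (𝓜.policyValue_le_optimalValue π s)

lemma exists_isOptimalPolicy : ∃ π, 𝓜.IsOptimalPolicy π := by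
  -- A policy of maximal total value cannot be improved by acting greedily for its value.
  obtain ⟨π, hπ⟩ := Finite.exists_max fun π : 𝓜.Policy => ∑ s, 𝓜.policyValue π s
  choose greedy h_greedy using fun s => Finite.exists_max fun a : 𝓜.Action s =>
    𝓜.reward s a + 𝓜.γ * 𝓜.utility (𝓜.policyValue π) ⟨s, a⟩
  have h_le : ∀ s, 𝓜.policyValue π s ≤ 𝓜.policyValue greedy s := le_policyValue fun s => by
    rw [𝓜.policyValue_eq_policyOp π s]
    exact h_greedy s (π s)
  have h_eq : 𝓜.policyValue π = 𝓜.policyValue greedy := funext fun s =>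
    (Finset.sum_eq_sum_iff_of_le fun s _ => h_le s).1
      (le_antisymm (Finset.sum_le_sum fun s _ => h_le s) (hπ greedy)) s (Finset.mem_univ s)
  refine ⟨π, fun s => le_antisymm (𝓜.policyValue_le_optimalValue π s) (ciSup_le fun ρ =>
    policyValue_le (fun s => (h_greedy s (ρ s)).trans_eq ?_) s)⟩
  have h_bellman := 𝓜.policyValue_eq_policyOp greedy s
  rwa [← h_eq, eq_comm] at h_bellman

variable {𝓜} in
lemma IsOptimalPolicy.optimalValue_eq {π : 𝓜.Policy} (h : 𝓜.IsOptimalPolicy π) (s : 𝓜.State) :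
    𝓜.optimalValue s = 𝓜.policyOp π 𝓜.optimalValue s := by
  rw [← show 𝓜.policyValue π = 𝓜.optimalValue from funext h]
  exact 𝓜.policyValue_eq_policyOp π s

/-- The vector `(I - γ P^π)⁻¹ ξ`: the accumulated discounted errors when the policy `π` incurs the
error `ξ s` at each visit of the state `s`. -/
def discountedError (π : 𝓜.Policy) (ξ : 𝓜.State → ℝ) : 𝓜.State → ℝ :=
  (1 - 𝓜.γ • 𝓜.policyMatrix π)⁻¹.mulVec ξ

lemma one_sub_smul_policyMatrix_mulVec (π : 𝓜.Policy) (u : 𝓜.State → ℝ) (s : 𝓜.State) :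
    (1 - 𝓜.γ • 𝓜.policyMatrix π).mulVec u s = u s - 𝓜.γ * 𝓜.utility u ⟨s, π s⟩ := by
  simp [Matrix.sub_mulVec, Matrix.smul_mulVec, policyMatrix_mulVec]

lemma isUnit_one_sub_smul_policyMatrix (π : 𝓜.Policy) :
    IsUnit (1 - 𝓜.γ • 𝓜.policyMatrix π) := by
  refine Matrix.mulVec_injective_iff_isUnit.1 fun u w huw => ?_
  have h_sol : ∀ s, u s - 𝓜.γ * 𝓜.utility u ⟨s, π s⟩ = w s - 𝓜.γ * 𝓜.utility w ⟨s, π s⟩ :=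
    fun s => by simpa only [one_sub_smul_policyMatrix_mulVec] using congrFun huw s
  refine funext fun s => le_antisymm ?_ ?_ <;>
    refine subsolution_le_supersolution
      (ξ := fun s => u s - 𝓜.γ * 𝓜.utility u ⟨s, π s⟩) (π := π) (fun s => ?_) (fun s => ?_) s <;>
    linarith [h_sol s]

lemma discountedError_eq (π : 𝓜.Policy) (ξ : 𝓜.State → ℝ) (s : 𝓜.State) :
    𝓜.discountedError π ξ s = ξ s + 𝓜.γ * 𝓜.utility (𝓜.discountedError π ξ) ⟨s, π s⟩ := by
  have h_unit := (Matrix.isUnit_iff_isUnit_det _).1 (𝓜.isUnit_one_sub_smul_policyMatrix π)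
  have h := 𝓜.one_sub_smul_policyMatrix_mulVec π (𝓜.discountedError π ξ) s
  rw [discountedError, Matrix.mulVec_mulVec, Matrix.mul_nonsing_inv _ h_unit,
    Matrix.one_mulVec] at h
  exact eq_add_of_sub_eq h.symm

lemma discountedError_nonneg (π : 𝓜.Policy) {ξ : 𝓜.State → ℝ} (hξ : ∀ s, 0 ≤ ξ s)
    (s : 𝓜.State) : 0 ≤ 𝓜.discountedError π ξ s :=
  subsolution_le_supersolution (u := fun _ => 0)
    (fun s => by rw [utility_const, mul_zero, add_zero]; exact hξ s)
    (fun s => (𝓜.discountedError_eq π ξ s).ge) s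

lemma discountedError_le (π : 𝓜.Policy) {ξ : 𝓜.State → ℝ} {K : ℝ}
    (hξ : ∀ s, ξ s ≤ (1 - 𝓜.γ) * K) (s : 𝓜.State) : 𝓜.discountedError π ξ s ≤ K :=
  subsolution_le_supersolution (w := fun _ => K)
    (fun s => (𝓜.discountedError_eq π ξ s).le)
    (fun s => by rw [utility_const]; linarith [hξ s]) s

lemma pow_iterCount_le : 𝓜.γ ^ 𝓜.iterCount ≤ 1 / 8 := by
  have h_exp : 𝓜.γ ≤ Real.exp (-(1 - 𝓜.γ)) := by
    linarith [Real.add_one_le_exp (-(1 - 𝓜.γ))]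
  have h_log : Real.log 8 ≤ 𝓜.iterCount * (1 - 𝓜.γ) :=
    (mul_inv_le_iff₀ 𝓜.one_sub_γ_pos).1 (Nat.le_ceil _)
  calc 𝓜.γ ^ 𝓜.iterCount ≤ Real.exp (-(1 - 𝓜.γ)) ^ 𝓜.iterCount :=
        pow_le_pow_left₀ 𝓜.γ_nonneg h_exp _
    _ = Real.exp (-(𝓜.iterCount * (1 - 𝓜.γ))) := by rw [← Real.exp_nat_mul, mul_neg]
    _ ≤ Real.exp (-Real.log 8) := Real.exp_le_exp.2 (neg_le_neg h_log)
    _ = 1 / 8 := by rw [Real.exp_neg, Real.exp_log (by norm_num), one_div]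

lemma iterCount_pos : 0 < 𝓜.iterCount :=
  Nat.ceil_pos.2 (mul_pos (Real.log_pos (by norm_num)) (inv_pos.2 𝓜.one_sub_γ_pos))

lemma Atot_pos : 0 < 𝓜.Atot :=
  Finset.sum_pos (fun s _ => 𝓜.numActions_pos s) Finset.univ_nonempty

lemma sampleCount_pos {δ : ℝ} (hδ : 0 < δ) (hδ1 : δ < 1) : 0 < 𝓜.sampleCount δ := by
  have hA : (1 : ℝ) ≤ 𝓜.Atot := by exact_mod_cast 𝓜.Atot_pos
  have hL : (0 : ℝ) < 𝓜.iterCount := by exact_mod_cast 𝓜.iterCount_pos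
  have h_log : 0 < Real.log (2 * 𝓜.Atot / δ) :=
    Real.log_pos ((one_lt_div hδ).2 (by linarith))
  exact Nat.ceil_pos.2 (by positivity)

end DMDP

/-! ### Truncated value iteration -/

namespace DMDP

variable (𝓜 : DMDP)

section Iteration

/-- The values `Q̃` of the actions in an iteration that starts from `I`. -/
def actionValue (x : 𝓜.Pair → ℝ) (I : 𝓜.Iterate) (p : 𝓜.Pair) : ℝ :=
  𝓜.reward p.1 p.2 + 𝓜.γ * (x p + I.gHat p)

/-- The truncated greedy value `ṽ` in an iteration that starts from `I`. -/
def truncatedValue (x : 𝓜.Pair → ℝ) (α : ℝ) (I : 𝓜.Iterate) (s : 𝓜.State) : ℝ :=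
  min (⨆ a : 𝓜.Action s, 𝓜.actionValue x I ⟨s, a⟩) (I.v s + (1 - 𝓜.γ) * α)

variable {𝓜} (am : 𝓜.SelectionRule) (x : 𝓜.Pair → ℝ) (α : ℝ) (M : ℕ) (ω : 𝓜.Tape) (ℓ : ℕ)
  (I : 𝓜.Iterate)

lemma iteration_v (s : 𝓜.State) :
    (𝓜.iteration am x α M ω ℓ I).v s = max (I.v s) (𝓜.truncatedValue x α I s) :=
  (max_def _ _).symm

lemma iteration_π (s : 𝓜.State) :
    (𝓜.iteration am x α M ω ℓ I).π s = if I.v s ≤ 𝓜.truncatedValue x α I s then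
      am s fun a => 𝓜.actionValue x I ⟨s, a⟩ else I.π s :=
  rfl

lemma iteration_g (p : 𝓜.Pair) :
    (𝓜.iteration am x α M ω ℓ I).g p = I.g p + (1 / (M : ℝ)) * ∑ j ∈ Finset.range M,
      ((𝓜.iteration am x α M ω ℓ I).v - I.v) (ω p (ℓ * M + j)) := by
  simp [iteration, apxUtility, sample]

lemma iteration_gHat (p : 𝓜.Pair) :
    (𝓜.iteration am x α M ω ℓ I).gHat p =
      (𝓜.iteration am x α M ω ℓ I).g p - (1 - 𝓜.γ) * α / 8 :=
  rfl

lemma le_iteration_v (s : 𝓜.State) : I.v s ≤ (𝓜.iteration am x α M ω ℓ I).v s :=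
  (le_max_left _ _).trans_eq (iteration_v am x α M ω ℓ I s).symm

variable {am x α I}

lemma iteration_v_le (hα : 0 ≤ α) (s : 𝓜.State) :
    (𝓜.iteration am x α M ω ℓ I).v s ≤ I.v s + (1 - 𝓜.γ) * α := by
  rw [iteration_v]
  exact max_le (le_add_of_nonneg_right (mul_nonneg 𝓜.one_sub_γ_pos.le hα)) (min_le_right _ _)

lemma iteration_v_le_policyOp (ham : 𝓜.IsArgmaxRule am)
    (hQ : ∀ p, 𝓜.actionValue x I p ≤ 𝓜.reward p.1 p.2 + 𝓜.γ * 𝓜.utility I.v p)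
    (hI : ∀ s, I.v s ≤ 𝓜.policyOp I.π I.v s) (s : 𝓜.State) :
    (𝓜.iteration am x α M ω ℓ I).v s ≤
      𝓜.policyOp (𝓜.iteration am x α M ω ℓ I).π (𝓜.iteration am x α M ω ℓ I).v s := by
  set J := 𝓜.iteration am x α M ω ℓ I
  suffices J.v s ≤ 𝓜.policyOp J.π I.v s from
    this.trans (add_le_add_right (𝓜.discounted_mono (le_iteration_v am x α M ω ℓ I) _) _)
  rw [policyOp, iteration_v, iteration_π]
  split_ifs with h_improve
  · rw [max_eq_right h_improve]
    exact (min_le_left _ _).trans (ciSup_le fun a =>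
      (ham s (fun a => 𝓜.actionValue x I ⟨s, a⟩) a).trans (hQ _))
  · rw [max_eq_left (not_le.1 h_improve).le]
    exact hI s

lemma sub_iteration_v_le {π : 𝓜.Policy} {u ξ : 𝓜.State → ℝ} {c : ℝ} (hc : c ≤ α)
    (hu : ∀ s, u s ≤ 𝓜.policyOp π u s)
    (hQ : ∀ s, 𝓜.policyOp π I.v s - ξ s ≤ 𝓜.actionValue x I ⟨s, π s⟩)
    (hI : ∀ s, u s - I.v s ≤ c + 𝓜.discountedError π ξ s) (s : 𝓜.State) :
    u s - (𝓜.iteration am x α M ω ℓ I).v s ≤ 𝓜.γ * c + 𝓜.discountedError π ξ s := by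
  have h_trunc : 𝓜.truncatedValue x α I s ≤ (𝓜.iteration am x α M ω ℓ I).v s :=
    (le_max_right _ _).trans_eq (iteration_v am x α M ω ℓ I s).symm
  rcases min_le_iff.1 h_trunc with h_greedy | h_full
  · have h_action : 𝓜.actionValue x I ⟨s, π s⟩ ≤ (𝓜.iteration am x α M ω ℓ I).v s :=
      (le_ciSup (f := fun a => 𝓜.actionValue x I ⟨s, a⟩)
        (Set.finite_range _).bddAbove (π s)).trans h_greedy
    have h_contract : 𝓜.γ * 𝓜.utility (u - I.v) ⟨s, π s⟩ ≤
        𝓜.γ * 𝓜.utility ((fun _ => c) + 𝓜.discountedError π ξ) ⟨s, π s⟩ :=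
      𝓜.discounted_mono hI _
    rw [utility_sub, utility_add, utility_const] at h_contract
    have hu_s := hu s
    have hQ_s := hQ s
    rw [policyOp] at hu_s hQ_s
    linarith [𝓜.discountedError_eq π ξ s]
  · have h_slack : (1 - 𝓜.γ) * c ≤ (1 - 𝓜.γ) * α :=
      mul_le_mul_of_nonneg_left hc 𝓜.one_sub_γ_pos.le
    linarith [hI s]

end Iteration

section Iterates

variable (am : 𝓜.SelectionRule) (v₀ : 𝓜.State → ℝ) (π₀ : 𝓜.Policy) (x : 𝓜.Pair → ℝ) (α : ℝ)
  (M : ℕ) (ω : 𝓜.Tape)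

/-- The event that the estimates `g` of `P (v - v₀)` are accurate in the first `L` iterations, up
to the shift `(1 - γ) α / 8` that turns `g` into `ĝ`. -/
def IsAccurate (L : ℕ) : Prop :=
  ∀ ℓ < L, ∀ p, |(𝓜.iterates am v₀ π₀ x α M ω ℓ).g p -
    𝓜.utility ((𝓜.iterates am v₀ π₀ x α M ω ℓ).v - v₀) p| ≤ (1 - 𝓜.γ) * α / 8

variable {𝓜 am v₀ π₀ x α M ω} {L ℓ : ℕ}

namespace IsAccurate

lemma gHat_mem_Icc (h : 𝓜.IsAccurate am v₀ π₀ x α M ω L) (hα : 0 ≤ α) (hℓ : ℓ < L)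
    (p : 𝓜.Pair) :
    (𝓜.iterates am v₀ π₀ x α M ω ℓ).gHat p ∈ Set.Icc
      (𝓜.utility ((𝓜.iterates am v₀ π₀ x α M ω ℓ).v - v₀) p - (1 - 𝓜.γ) * α / 4)
      (𝓜.utility ((𝓜.iterates am v₀ π₀ x α M ω ℓ).v - v₀) p) := by
  cases ℓ with
  | zero =>
    have h_zero : 𝓜.utility (v₀ - v₀) p = 0 := by rw [utility_sub, sub_self]
    have h_shift : 0 ≤ (1 - 𝓜.γ) * α := mul_nonneg 𝓜.one_sub_γ_pos.le hα
    simp only [iterates, h_zero, Pi.zero_apply, Set.mem_Icc]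
    constructor <;> linarith
  | succ ℓ =>
    have h_acc := abs_le.1 (h (ℓ + 1) hℓ p)
    rw [iterates, iteration_gHat, Set.mem_Icc]
    rw [iterates] at h_acc
    constructor <;> linarith

variable {β : 𝓜.Pair → ℝ}

lemma actionValue_mem_Icc (h : 𝓜.IsAccurate am v₀ π₀ x α M ω L) (hα : 0 ≤ α)
    (hx : ∀ p, 𝓜.utility v₀ p - β p ≤ x p ∧ x p ≤ 𝓜.utility v₀ p) (hℓ : ℓ < L) (p : 𝓜.Pair) :
    𝓜.actionValue x (𝓜.iterates am v₀ π₀ x α M ω ℓ) p ∈ Set.Icc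
      (𝓜.reward p.1 p.2 + 𝓜.γ * 𝓜.utility (𝓜.iterates am v₀ π₀ x α M ω ℓ).v p -
        𝓜.γ * ((1 - 𝓜.γ) / 4 * α + β p))
      (𝓜.reward p.1 p.2 + 𝓜.γ * 𝓜.utility (𝓜.iterates am v₀ π₀ x α M ω ℓ).v p) := by
  obtain ⟨hg_lower, hg_upper⟩ := h.gHat_mem_Icc hα hℓ p
  rw [utility_sub] at hg_lower hg_upper
  rw [actionValue, Set.mem_Icc, add_sub_assoc, ← mul_sub]
  constructor <;> refine add_le_add_right (mul_le_mul_of_nonneg_left ?_ 𝓜.γ_nonneg) _ <;>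
    linarith [(hx p).1, (hx p).2]

lemma iterates_v_le_policyOp (h : 𝓜.IsAccurate am v₀ π₀ x α M ω L) (ham : 𝓜.IsArgmaxRule am)
    (hα : 0 ≤ α) (hx : ∀ p, 𝓜.utility v₀ p - β p ≤ x p ∧ x p ≤ 𝓜.utility v₀ p)
    (hv : ∀ s, v₀ s ≤ 𝓜.policyOp π₀ v₀ s) (hℓ : ℓ ≤ L) (s : 𝓜.State) :
    (𝓜.iterates am v₀ π₀ x α M ω ℓ).v s ≤
      𝓜.policyOp (𝓜.iterates am v₀ π₀ x α M ω ℓ).π (𝓜.iterates am v₀ π₀ x α M ω ℓ).v s := by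
  induction ℓ generalizing s with
  | zero => exact hv s
  | succ ℓ ih =>
    exact iteration_v_le_policyOp M ω ℓ ham (fun p => (h.actionValue_mem_Icc hα hx hℓ p).2)
      (ih (Nat.le_of_succ_le hℓ)) s

lemma optimalValue_sub_iterates_v_le (h : 𝓜.IsAccurate am v₀ π₀ x α M ω L) (hα : 0 ≤ α)
    (hx : ∀ p, 𝓜.utility v₀ p - β p ≤ x p ∧ x p ≤ 𝓜.utility v₀ p)
    (hv : ∀ s, 𝓜.optimalValue s - α ≤ v₀ s) {πs : 𝓜.Policy} (hπs : 𝓜.IsOptimalPolicy πs)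
    (hℓ : ℓ ≤ L) (s : 𝓜.State) :
    𝓜.optimalValue s - (𝓜.iterates am v₀ π₀ x α M ω ℓ).v s ≤ 𝓜.γ ^ ℓ * α +
      𝓜.discountedError πs (fun s => 𝓜.γ * ((1 - 𝓜.γ) / 4 * α + β ⟨s, πs s⟩)) s := by
  induction ℓ generalizing s with
  | zero =>
    have h_shift : 0 ≤ (1 - 𝓜.γ) / 4 * α :=
      mul_nonneg (div_nonneg 𝓜.one_sub_γ_pos.le (by norm_num)) hα
    have h_err := 𝓜.discountedError_nonneg πs
      (ξ := fun s => 𝓜.γ * ((1 - 𝓜.γ) / 4 * α + β ⟨s, πs s⟩))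
      (fun s => mul_nonneg 𝓜.γ_nonneg (by linarith [hx ⟨s, πs s⟩])) s
    rw [iterates, pow_zero, one_mul]
    linarith [hv s]
  | succ ℓ ih =>
    rw [pow_succ', mul_assoc]
    exact sub_iteration_v_le M ω ℓ
      (mul_le_of_le_one_left hα (pow_le_one₀ 𝓜.γ_nonneg 𝓜.γ_lt_one.le))
      (fun s => (hπs.optimalValue_eq s).le)
      (fun s => (h.actionValue_mem_Icc hα hx hℓ ⟨s, πs s⟩).1) (ih (Nat.le_of_succ_le hℓ)) s

lemma optimalValue_sub_iterates_v_le_half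
    (h : 𝓜.IsAccurate am v₀ π₀ x α M ω 𝓜.iterCount) (hα : 0 ≤ α) (hx : ∀ p, x p = 𝓜.utility v₀ p)
    (hv : ∀ s, 𝓜.optimalValue s - α ≤ v₀ s) (s : 𝓜.State) :
    𝓜.optimalValue s - (𝓜.iterates am v₀ π₀ x α M ω 𝓜.iterCount).v s ≤ α / 2 := by
  obtain ⟨πs, hπs⟩ := 𝓜.exists_isOptimalPolicy
  have h_main := h.optimalValue_sub_iterates_v_le (β := 0) hα
    (fun p => ⟨by simp [hx p], (hx p).le⟩) hv hπs le_rfl s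
  have h_discount : 𝓜.γ * ((1 - 𝓜.γ) * α) ≤ (1 - 𝓜.γ) * α :=
    mul_le_of_le_one_left (mul_nonneg 𝓜.one_sub_γ_pos.le hα) 𝓜.γ_lt_one.le
  have h_err := 𝓜.discountedError_le πs
    (ξ := fun s => 𝓜.γ * ((1 - 𝓜.γ) / 4 * α + (0 : 𝓜.Pair → ℝ) ⟨s, πs s⟩)) (K := α / 4)
    (fun s => by rw [Pi.zero_apply]; linarith) s
  have h_pow : 𝓜.γ ^ 𝓜.iterCount * α ≤ 1 / 8 * α :=
    mul_le_mul_of_nonneg_right 𝓜.pow_iterCount_le hα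
  linarith

end IsAccurate

end Iterates

end DMDP

/-! ### Concentration of the sample means -/

lemma integral_comp_le_of_indepFun {Ω A B : Type*} [MeasurableSpace Ω] {μ : Measure Ω}
    [IsProbabilityMeasure μ] [Finite A] [MeasurableSpace A] [MeasurableSingletonClass A]
    [Finite B] [MeasurableSpace B] [MeasurableSingletonClass B] {F : Ω → A} {Y : Ω → B}
    (hF : Measurable F) (hY : Measurable Y) (h : IndepFun F Y μ) {f : A → B → ℝ} {g : A → ℝ}
    (hfg : ∀ a, ∫ ω, f a (Y ω) ∂μ ≤ g a) :
    ∫ ω, f (F ω) (Y ω) ∂μ ≤ ∫ ω, g (F ω) ∂μ := by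
  have := Measure.isProbabilityMeasure_map (μ := μ) hF.aemeasurable
  have := Measure.isProbabilityMeasure_map (μ := μ) hY.aemeasurable
  calc ∫ ω, f (F ω) (Y ω) ∂μ = ∫ z, f z.1 z.2 ∂(μ.map F).prod (μ.map Y) := by
        rw [← (indepFun_iff_map_prod_eq_prod_map_map hF.aemeasurable hY.aemeasurable).1 h,
          integral_map (hF.prodMk hY).aemeasurable
            (measurable_of_finite _).aestronglyMeasurable]
    _ = ∫ a, ∫ b, f a b ∂μ.map Y ∂μ.map F := integral_prod _ Integrable.of_finite
    _ ≤ ∫ a, g a ∂μ.map F := by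
        refine integral_mono Integrable.of_finite Integrable.of_finite fun a => ?_
        simpa only [integral_map hY.aemeasurable
          (measurable_of_finite (f a)).aestronglyMeasurable] using hfg a
    _ = ∫ ω, g (F ω) ∂μ :=
        integral_map hF.aemeasurable (measurable_of_finite g).aestronglyMeasurable

lemma measureReal_exists_le_submartingale_le {Ω : Type*} [mΩ : MeasurableSpace Ω] {μ : Measure Ω}
    [IsFiniteMeasure μ] {𝒢 : Filtration ℕ mΩ} {f : ℕ → Ω → ℝ} (hf : Submartingale f 𝒢 μ)
    (hf0 : 0 ≤ f) {ε : ℝ} (hε : 0 < ε) (n : ℕ) :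
    μ.real {ω | ∃ ℓ ≤ n, ε ≤ f ℓ ω} ≤ (∫ ω, f n ω ∂μ) / ε := by
  lift ε to NNReal using hε.le
  have h_doob := maximal_ineq hf hf0 (ε := ε) n
  simp only [Finset.le_sup'_iff, Finset.mem_range, Nat.lt_succ_iff] at h_doob
  rw [le_div_iff₀' hε]
  have h_real := ENNReal.toReal_mono ENNReal.ofReal_ne_top h_doob
  rw [ENNReal.toReal_mul, ENNReal.coe_toReal,
    ENNReal.toReal_ofReal (integral_nonneg fun ω => hf0 n ω)] at h_real
  exact h_real.trans (setIntegral_le_integral (hf.integrable n) (ae_of_all _ (hf0 n)))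

namespace DMDP

variable {𝓜 : DMDP}

/-- The random variable `f` of the answers is determined by the first `n` answers for every
state-action pair. -/
def DependsOnFirst {β : Type*} (n : ℕ) (f : 𝓜.Tape → β) : Prop :=
  ∀ ω ω' : 𝓜.Tape, (∀ p, ∀ j < n, ω p j = ω' p j) → f ω = f ω'

/-- The error of the mean of the `M` answers `n, …, n + M - 1` for the pair `p` as an estimate of
the expectation of `w`. -/
def blockError (w : 𝓜.State → ℝ) (M n : ℕ) (p : 𝓜.Pair) (ω : 𝓜.Tape) : ℝ :=
  (1 / (M : ℝ)) * ∑ j ∈ Finset.range M, w (ω p (n + j)) - 𝓜.utility w p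

/-- The accumulated error after `ℓ` blocks of `M` samples, if block `k` estimates the expectation
of `u k`. -/
def totalError (u : ℕ → 𝓜.Tape → 𝓜.State → ℝ) (M : ℕ) (p : 𝓜.Pair) (ℓ : ℕ) (ω : 𝓜.Tape) : ℝ :=
  ∑ k ∈ Finset.range ℓ, blockError (u k ω) M (k * M) p ω

namespace DependsOnFirst

variable {β γ : Type*} {n m : ℕ} {f : 𝓜.Tape → β}

lemma mono (hf : DependsOnFirst n f) (h : n ≤ m) : DependsOnFirst m f :=
  fun ω ω' hω => hf ω ω' fun p j hj => hω p j (hj.trans_le h)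

lemma comp (hf : DependsOnFirst n f) (g : β → γ) : DependsOnFirst n fun ω => g (f ω) :=
  fun ω ω' hω => congrArg g (hf ω ω' hω)

end DependsOnFirst

lemma dependsOnFirst_blockError {n : ℕ} {u : 𝓜.Tape → 𝓜.State → ℝ} (hu : DependsOnFirst n u)
    (M : ℕ) (p : 𝓜.Pair) : DependsOnFirst (n + M) fun ω => blockError (u ω) M n p ω := by
  intro ω ω' hω
  have h_block : ∀ j ∈ Finset.range M, ω p (n + j) = ω' p (n + j) := fun j hj =>
    hω p _ (Nat.add_lt_add_left (Finset.mem_range.1 hj) n)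
  simp only [blockError, hu.mono (Nat.le_add_right n M) ω ω' hω]
  rw [Finset.sum_congr rfl fun j hj => by rw [h_block j hj]]

section Predictable

variable {M : ℕ} {u : ℕ → 𝓜.Tape → 𝓜.State → ℝ}

lemma dependsOnFirst_totalError (hu : ∀ k, DependsOnFirst (k * M) (u k)) (p : 𝓜.Pair) (ℓ : ℕ) :
    DependsOnFirst (ℓ * M) (totalError u M p ℓ) := fun ω ω' hω =>
  Finset.sum_congr rfl fun k hk => by
    refine (dependsOnFirst_blockError (hu k) M p).mono ?_ ω ω' hω
    rw [← Nat.succ_mul]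
    exact Nat.mul_le_mul_right M (Finset.mem_range.1 hk)

lemma exp_totalError_succ (t : ℝ) (p : 𝓜.Pair) (ℓ : ℕ) (ω : 𝓜.Tape) :
    Real.exp (t * totalError u M p (ℓ + 1) ω) =
      Real.exp (t * totalError u M p ℓ ω) * Real.exp (t * blockError (u ℓ ω) M (ℓ * M) p ω) := by
  rw [totalError, Finset.sum_range_succ, mul_add, Real.exp_add]
  rfl

end Predictable

section Tape

variable {Ω : Type*} (X : 𝓜.Pair → ℕ → Ω → 𝓜.State)

/-- The sequence of random answers as a random tape. -/
def tape (ω : Ω) : 𝓜.Tape := fun p j => X p j ω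

/-- The first `n` answers for every state-action pair. -/
def history (n : ℕ) (ω : Ω) : 𝓜.Pair → Fin n → 𝓜.State := fun p j => X p j ω

/-- Some tape with the given first answers. -/
def extendHistory {n : ℕ} (h : 𝓜.Pair → Fin n → 𝓜.State) : 𝓜.Tape := fun p j =>
  if hj : j < n then h p ⟨j, hj⟩ else Classical.arbitrary _

variable {X}

lemma DependsOnFirst.extendHistory_eq {β : Type*} {n : ℕ} {f : 𝓜.Tape → β}
    (hf : DependsOnFirst n f) (ω : Ω) : f (extendHistory (history X n ω)) = f (tape X ω) :=
  hf _ _ fun _ _ hj => dif_pos hj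

end Tape

variable {Ω : Type*} [mΩ : MeasurableSpace Ω] {μ : Measure Ω} {X : 𝓜.Pair → ℕ → Ω → 𝓜.State}

namespace IsGenerativeModel

lemma measurable_history (hX : 𝓜.IsGenerativeModel μ X) (n : ℕ) : Measurable (history X n) :=
  measurable_pi_lambda _ fun p => measurable_pi_lambda _ fun j => hX.measurable p j

/-- The information that is available after `ℓ` blocks of `M` queries of every pair. -/
def filtration (hX : 𝓜.IsGenerativeModel μ X) (M : ℕ) : Filtration ℕ mΩ where
  seq ℓ := MeasurableSpace.comap (history X (ℓ * M)) inferInstance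
  mono' ℓ ℓ' h := by
    rintro _ ⟨S, -, rfl⟩
    exact ⟨(fun a p j => a p (Fin.castLE (Nat.mul_le_mul_right M h) j)) ⁻¹' S,
      (Set.toFinite _).measurableSet, rfl⟩
  le' ℓ := (hX.measurable_history (ℓ * M)).comap_le

lemma stronglyMeasurable_filtration (hX : 𝓜.IsGenerativeModel μ X) {M ℓ : ℕ} {f : 𝓜.Tape → ℝ}
    (hf : DependsOnFirst (ℓ * M) f) :
    StronglyMeasurable[hX.filtration M ℓ] fun ω => f (tape X ω) := by
  simp only [← hf.extendHistory_eq]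
  exact ((measurable_of_finite fun a => f (extendHistory a)).comp
    (comap_measurable _)).stronglyMeasurable

lemma integrable (hX : 𝓜.IsGenerativeModel μ X) [IsFiniteMeasure μ] {n : ℕ} {f : 𝓜.Tape → ℝ}
    (hf : DependsOnFirst n f) : Integrable (fun ω => f (tape X ω)) μ := by
  simp only [← hf.extendHistory_eq]
  exact (Integrable.of_finite (μ := μ.map (history X n))
    (f := fun a => f (extendHistory a))).comp_measurable (hX.measurable_history n)

lemma indepFun_history (hX : 𝓜.IsGenerativeModel μ X) (p : 𝓜.Pair) (n M : ℕ) :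
    IndepFun (history X n) (fun ω (j : Fin M) => X p (n + j) ω) μ := by
  classical
  let past : Finset (𝓜.Pair × ℕ) := Finset.univ ×ˢ Finset.range n
  let fresh : Finset (𝓜.Pair × ℕ) := {p} ×ˢ Finset.Ico n (n + M)
  have h_disj : Disjoint past fresh := Finset.disjoint_left.2 fun q hq hq' => by
    simp only [past, fresh, Finset.mem_product, Finset.mem_range, Finset.mem_Ico] at hq hq'
    omega
  have h_indep := hX.indep.indepFun_finset past fresh h_disj fun q => hX.measurable q.1 q.2
  exact h_indep.comp
    (φ := fun a p (j : Fin n) => a ⟨(p, j), by simp [past]⟩)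
    (ψ := fun b (j : Fin M) => b ⟨(p, n + j), by simp [fresh]⟩)
    (measurable_of_finite _) (measurable_of_finite _)

variable [IsProbabilityMeasure μ]

lemma integral_eq_utility (hX : 𝓜.IsGenerativeModel μ X) (u : 𝓜.State → ℝ) (p : 𝓜.Pair) (j : ℕ) :
    ∫ ω, u (X p j ω) ∂μ = 𝓜.utility u p := by
  have h_meas := hX.measurable p j
  rw [← integral_map (f := u) h_meas.aemeasurable
    (measurable_of_finite u).aestronglyMeasurable, integral_fintype Integrable.of_finite, utility]
  refine Finset.sum_congr rfl fun t _ => ?_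
  rw [map_measureReal_apply h_meas (measurableSet_singleton t), smul_eq_mul, ← hX.law p j t]
  rfl

lemma integrable_comp (hX : 𝓜.IsGenerativeModel μ X) (u : 𝓜.State → ℝ) (p : 𝓜.Pair) (j : ℕ) :
    Integrable (fun ω => u (X p j ω)) μ :=
  (Integrable.of_finite (f := u) (μ := μ.map (X p j))).comp_measurable (hX.measurable p j)

lemma integral_blockError (hX : 𝓜.IsGenerativeModel μ X) (w : 𝓜.State → ℝ) {M : ℕ} (hM : 0 < M)
    (n : ℕ) (p : 𝓜.Pair) : ∫ ω, blockError w M n p (tape X ω) ∂μ = 0 := by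
  have h_int : ∀ j ∈ Finset.range M, Integrable (fun ω => w (tape X ω p (n + j))) μ :=
    fun j _ => hX.integrable_comp w p (n + j)
  have h_mean : ∀ j, ∫ ω, w (tape X ω p (n + j)) ∂μ = 𝓜.utility w p :=
    fun j => hX.integral_eq_utility w p (n + j)
  simp only [blockError]
  rw [integral_sub ((integrable_finsetSum _ h_int).const_mul _) (integrable_const _),
    integral_const_mul, integral_finsetSum _ h_int]
  simp only [h_mean, Finset.sum_const, Finset.card_range, nsmul_eq_mul, integral_const,
    probReal_univ, one_smul]
  field_simp
  ring

lemma hasSubgaussianMGF_blockError (hX : 𝓜.IsGenerativeModel μ X) {w : 𝓜.State → ℝ} {c : ℝ}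
    (hw : ∀ s, w s ∈ Set.Icc 0 c) (M n : ℕ) (p : 𝓜.Pair) :
    HasSubgaussianMGF (fun ω => ∑ j ∈ Finset.range M, (w (X p (n + j) ω) - 𝓜.utility w p))
      (∑ _j ∈ Finset.range M, (‖c - 0‖₊ / 2) ^ 2) μ := by
  have h_indep : iIndepFun (fun j ω => w (X p (n + j) ω) - 𝓜.utility w p) μ :=
    (hX.indep.precomp (g := fun j => (p, n + j)) fun i j h => by simpa using h).comp
      (fun _ s => w s - 𝓜.utility w p) fun _ => measurable_of_finite _
  refine HasSubgaussianMGF.sum_of_iIndepFun h_indep fun j _ => ?_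
  rw [← hX.integral_eq_utility w p (n + j)]
  exact hasSubgaussianMGF_of_mem_Icc
    ((measurable_of_finite w).comp (hX.measurable p (n + j))).aemeasurable
    (ae_of_all _ fun ω => hw _)

lemma integral_exp_blockError_le (hX : 𝓜.IsGenerativeModel μ X) {w : 𝓜.State → ℝ} {c : ℝ}
    (hw : ∀ s, w s ∈ Set.Icc 0 c) {M : ℕ} (hM : 0 < M) (n : ℕ) (p : 𝓜.Pair) (t : ℝ) :
    ∫ ω, Real.exp (t * blockError w M n p (tape X ω)) ∂μ ≤
      Real.exp (t ^ 2 * c ^ 2 / (8 * M)) := by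
  have hM' : (M : ℝ) ≠ 0 := by positivity
  have h_scale : ∀ ω, t * blockError w M n p (tape X ω) =
      t / M * ∑ j ∈ Finset.range M, (w (X p (n + j) ω) - 𝓜.utility w p) := fun ω => by
    simp only [blockError, tape, Finset.sum_sub_distrib, Finset.sum_const, Finset.card_range,
      nsmul_eq_mul]
    field_simp
  simp only [h_scale]
  refine ((hX.hasSubgaussianMGF_blockError hw M n p).mgf_le (t / M)).trans_eq ?_
  simp only [Finset.sum_const, Finset.card_range, nsmul_eq_mul, NNReal.coe_mul, NNReal.coe_pow,
    NNReal.coe_div, coe_nnnorm, NNReal.coe_natCast, NNReal.coe_ofNat, sub_zero, Real.norm_eq_abs,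
    div_pow, sq_abs]
  congr 1
  field_simp
  ring

lemma one_le_integral_exp_blockError (hX : 𝓜.IsGenerativeModel μ X) (w : 𝓜.State → ℝ) {M : ℕ}
    (hM : 0 < M) (n : ℕ) (p : 𝓜.Pair) (t : ℝ) :
    1 ≤ ∫ ω, Real.exp (t * blockError w M n p (tape X ω)) ∂μ := by
  have h_dep : DependsOnFirst (n + M) (blockError w M n p) :=
    dependsOnFirst_blockError (u := fun _ => w) (fun _ _ _ => rfl) M p
  calc (1 : ℝ) = ∫ ω, (t * blockError w M n p (tape X ω) + 1) ∂μ := by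
        rw [integral_add ((hX.integrable h_dep).const_mul t) (integrable_const 1),
          integral_const_mul, hX.integral_blockError w hM]
        simp
    _ ≤ ∫ ω, Real.exp (t * blockError w M n p (tape X ω)) ∂μ :=
        integral_mono (hX.integrable (h_dep.comp fun e => t * e + 1))
          (hX.integrable (h_dep.comp fun e => Real.exp (t * e))) fun ω => Real.add_one_le_exp _

lemma integral_mul_comp_blockError_le (hX : 𝓜.IsGenerativeModel μ X) {M n : ℕ}
    {f : 𝓜.Tape → ℝ} (hf : DependsOnFirst n f) (hf0 : ∀ ω, 0 ≤ f ω)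
    {u : 𝓜.Tape → 𝓜.State → ℝ} (hu : DependsOnFirst n u) (p : 𝓜.Pair) {φ : ℝ → ℝ} {C : ℝ}
    (hφ : ∀ ω, ∫ ω', φ (blockError (u ω) M n p (tape X ω')) ∂μ ≤ C) :
    ∫ ω, f (tape X ω) * φ (blockError (u (tape X ω)) M n p (tape X ω)) ∂μ ≤
      ∫ ω, f (tape X ω) * C ∂μ := by
  let freshError (w : 𝓜.State → ℝ) (b : Fin M → 𝓜.State) : ℝ :=
    (1 / (M : ℝ)) * ∑ j, w (b j) - 𝓜.utility w p
  have h_fresh : ∀ w ω, blockError w M n p (tape X ω) =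
      freshError w fun j => X p (n + j) ω := fun w ω => by
    rw [blockError, Finset.sum_range]
    rfl
  have h_freeze := integral_comp_le_of_indepFun (hX.measurable_history n)
    (measurable_pi_lambda _ fun j : Fin M => hX.measurable p (n + j)) (hX.indepFun_history p n M)
    (f := fun a b => f (extendHistory a) * φ (freshError (u (extendHistory a)) b))
    (g := fun a => f (extendHistory a) * C) fun a => by
      rw [integral_const_mul]
      refine mul_le_mul_of_nonneg_left ?_ (hf0 _)
      simpa only [h_fresh] using hφ (extendHistory a)
  simpa only [hf.extendHistory_eq, hu.extendHistory_eq, ← h_fresh] using h_freeze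

section Predictable

variable {M : ℕ} {u : ℕ → 𝓜.Tape → 𝓜.State → ℝ}

lemma submartingale_exp_totalError (hX : 𝓜.IsGenerativeModel μ X) (hM : 0 < M)
    (hu : ∀ k, DependsOnFirst (k * M) (u k)) (p : 𝓜.Pair) (t : ℝ) :
    Submartingale (fun ℓ ω => Real.exp (t * totalError u M p ℓ (tape X ω)))
      (hX.filtration M) μ := by
  classical
  have h_dep : ∀ ℓ, DependsOnFirst (ℓ * M) fun ω => Real.exp (t * totalError u M p ℓ ω) :=
    fun ℓ => (dependsOnFirst_totalError hu p ℓ).comp fun e => Real.exp (t * e)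
  refine submartingale_of_setIntegral_le_succ
    (fun ℓ => hX.stronglyMeasurable_filtration (h_dep ℓ)) (fun ℓ => hX.integrable (h_dep ℓ))
    fun ℓ A hA => ?_
  have hA_meas : MeasurableSet A := (hX.filtration M).le ℓ A hA
  obtain ⟨S, -, rfl⟩ := hA
  let f : 𝓜.Tape → ℝ := fun ω =>
    if (fun p (j : Fin (ℓ * M)) => ω p j) ∈ S then Real.exp (t * totalError u M p ℓ ω) else 0
  have hf : DependsOnFirst (ℓ * M) f := fun ω ω' hω => by
    have h_hist : (fun p (j : Fin (ℓ * M)) => ω p j) = fun p (j : Fin (ℓ * M)) => ω' p j :=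
      funext fun p => funext fun j => hω p j j.2
    simp only [f, h_hist, dependsOnFirst_totalError hu p ℓ ω ω' hω]
  have h_ind : ∀ (g : Ω → ℝ), ∫ ω in history X (ℓ * M) ⁻¹' S,
      Real.exp (t * totalError u M p ℓ (tape X ω)) * g ω ∂μ = ∫ ω, f (tape X ω) * g ω ∂μ :=
    fun g => by
      rw [← integral_indicator hA_meas]
      refine integral_congr_ae (ae_of_all _ fun ω => ?_)
      simp only [f, ite_mul, zero_mul]
      rfl
  have h_step := hX.integral_mul_comp_blockError_le (M := M) hf
    (fun ω => by dsimp only [f]; split_ifs <;> positivity) (hu ℓ) p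
    (φ := fun e => -Real.exp (t * e)) (C := -1) fun ω => by
      rw [integral_neg]
      exact neg_le_neg (hX.one_le_integral_exp_blockError (u ℓ ω) hM (ℓ * M) p t)
  simp only [← h_ind, mul_neg, integral_neg, neg_le_neg_iff] at h_step
  simpa only [exp_totalError_succ, mul_one] using h_step

lemma integral_exp_totalError_le (hX : 𝓜.IsGenerativeModel μ X) (hM : 0 < M)
    (hu : ∀ k, DependsOnFirst (k * M) (u k)) {c : ℝ} (hc : ∀ k ω s, u k ω s ∈ Set.Icc 0 c)
    (p : 𝓜.Pair) (t : ℝ) (n : ℕ) :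
    ∫ ω, Real.exp (t * totalError u M p n (tape X ω)) ∂μ ≤
      Real.exp (n * (t ^ 2 * c ^ 2 / (8 * M))) := by
  induction n with
  | zero => simp [totalError]
  | succ n ih =>
    simp only [exp_totalError_succ]
    refine (hX.integral_mul_comp_blockError_le
      ((dependsOnFirst_totalError hu p n).comp fun e => Real.exp (t * e))
      (fun ω => (Real.exp_pos _).le) (hu n) p (φ := fun e => Real.exp (t * e))
      fun ω => hX.integral_exp_blockError_le (hc n ω) hM (n * M) p t).trans ?_
    rw [integral_mul_const, Nat.cast_succ, add_one_mul, Real.exp_add]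
    exact mul_le_mul_of_nonneg_right ih (Real.exp_pos _).le

lemma measureReal_exists_le_mul_totalError_le (hX : 𝓜.IsGenerativeModel μ X) (hM : 0 < M)
    (hu : ∀ k, DependsOnFirst (k * M) (u k)) {c : ℝ} (hc : ∀ k ω s, u k ω s ∈ Set.Icc 0 c)
    (p : 𝓜.Pair) (t a : ℝ) (n : ℕ) :
    μ.real {ω | ∃ ℓ ≤ n, a ≤ t * totalError u M p ℓ (tape X ω)} ≤
      Real.exp (n * (t ^ 2 * c ^ 2 / (8 * M)) - a) := by
  have h_doob := measureReal_exists_le_submartingale_le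
    (hX.submartingale_exp_totalError hM hu p t) (fun ℓ ω => (Real.exp_pos _).le)
    (Real.exp_pos a) n
  simp only [Real.exp_le_exp] at h_doob
  rw [Real.exp_sub]
  exact h_doob.trans (div_le_div_of_nonneg_right (hX.integral_exp_totalError_le hM hu hc p t n)
    (Real.exp_pos a).le)

lemma measureReal_exists_lt_abs_totalError_le (hX : 𝓜.IsGenerativeModel μ X) (hM : 0 < M)
    (hu : ∀ k, DependsOnFirst (k * M) (u k)) {c : ℝ} (hc : ∀ k ω s, u k ω s ∈ Set.Icc 0 c)
    (hc0 : 0 < c) (p : 𝓜.Pair) {r : ℝ} (hr : 0 ≤ r) {n : ℕ} (hn : 0 < n) :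
    μ.real {ω | ∃ ℓ ≤ n, r < |totalError u M p ℓ (tape X ω)|} ≤
      2 * Real.exp (-(2 * M * r ^ 2 / (n * c ^ 2))) := by
  -- The parameter that minimizes `n t² c² / (8 M) - t r`.
  set t : ℝ := 4 * M * r / (n * c ^ 2) with ht
  have ht0 : 0 ≤ t := by positivity
  let exceeds (t : ℝ) : Set Ω := {ω | ∃ ℓ ≤ n, |t| * r ≤ t * totalError u M p ℓ (tape X ω)}
  have h_sub : {ω | ∃ ℓ ≤ n, r < |totalError u M p ℓ (tape X ω)|} ⊆ exceeds t ∪ exceeds (-t) := by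
    rintro ω ⟨ℓ, hℓ, h_err⟩
    refine (lt_abs.1 h_err).imp (fun h => ⟨ℓ, hℓ, ?_⟩) fun h => ⟨ℓ, hℓ, ?_⟩
    · rw [abs_of_nonneg ht0]
      exact mul_le_mul_of_nonneg_left h.le ht0
    · rw [abs_neg, abs_of_nonneg ht0, neg_mul_comm]
      exact mul_le_mul_of_nonneg_left h.le ht0
  have h_exceeds : ∀ t', |t'| = t →
      μ.real (exceeds t') ≤ Real.exp (-(2 * M * r ^ 2 / (n * c ^ 2))) := fun t' ht' => by
    refine (hX.measureReal_exists_le_mul_totalError_le hM hu hc p t' _ n).trans_eq ?_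
    rw [← sq_abs, ht', ht]
    congr 1
    field_simp
    ring
  rw [two_mul]
  exact (measureReal_mono h_sub).trans ((measureReal_union_le _ _).trans (add_le_add
    (h_exceeds t (abs_of_nonneg ht0)) (h_exceeds (-t) (by rw [abs_neg, abs_of_nonneg ht0]))))

end Predictable

end IsGenerativeModel

end DMDP

/-! ### Accuracy of the estimates with high probability -/

namespace DMDP

variable {𝓜 : DMDP}

lemma card_pair : Fintype.card 𝓜.Pair = 𝓜.Atot := by
  simp [Atot, Fintype.card_sigma]

variable (am : 𝓜.SelectionRule) (v₀ : 𝓜.State → ℝ) (π₀ : 𝓜.Policy) (x : 𝓜.Pair → ℝ) (α : ℝ)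
  (M : ℕ)

/-- The increase of the value vector in iteration `ℓ`, as a function of the answers. -/
def increment (ℓ : ℕ) (ω : 𝓜.Tape) : 𝓜.State → ℝ :=
  (𝓜.iterates am v₀ π₀ x α M ω (ℓ + 1)).v - (𝓜.iterates am v₀ π₀ x α M ω ℓ).v

lemma dependsOnFirst_iterates (ℓ : ℕ) :
    DependsOnFirst (ℓ * M) fun ω : 𝓜.Tape => 𝓜.iterates am v₀ π₀ x α M ω ℓ := by
  induction ℓ with
  | zero => exact fun _ _ _ => rfl
  | succ ℓ ih =>
    intro ω ω' hω
    rw [Nat.succ_mul] at hω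
    have h_est : ∀ u p, 𝓜.apxUtility u M 0 (fun p j => ω p (ℓ * M + j)) p =
        𝓜.apxUtility u M 0 (fun p j => ω' p (ℓ * M + j)) p := fun u p => by
      have h_block : ∀ j ∈ Finset.range M, ω p (ℓ * M + j) = ω' p (ℓ * M + j) := fun j hj =>
        hω p _ (Nat.add_lt_add_left (Finset.mem_range.1 hj) _)
      simp only [apxUtility, sample, Finset.sum_congr rfl fun j hj =>
        congrArg u (h_block j hj), Finset.sum_congr rfl fun j hj =>
        congrArg (fun s => u s ^ 2) (h_block j hj)]
    simp only [iterates, ih.mono (Nat.le_add_right _ M) ω ω' hω, iteration, funext (h_est _)]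

lemma dependsOnFirst_increment (ℓ : ℕ) :
    DependsOnFirst (ℓ * M) (𝓜.increment am v₀ π₀ x α M ℓ) := fun ω ω' hω => by
  have h := dependsOnFirst_iterates am v₀ π₀ x α M ℓ ω ω' hω
  simp only [increment, iterates, iteration, h]

variable {α} in
lemma increment_mem_Icc (hα : 0 ≤ α) (ℓ : ℕ) (ω : 𝓜.Tape) (s : 𝓜.State) :
    increment am v₀ π₀ x α M ℓ ω s ∈ Set.Icc 0 ((1 - 𝓜.γ) * α) :=
  ⟨sub_nonneg.2 (le_iteration_v ..), sub_le_iff_le_add'.2 (iteration_v_le M ω ℓ hα s)⟩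

lemma totalError_increment (p : 𝓜.Pair) (ℓ : ℕ) (ω : 𝓜.Tape) :
    totalError (increment am v₀ π₀ x α M) M p ℓ ω = (𝓜.iterates am v₀ π₀ x α M ω ℓ).g p -
      𝓜.utility ((𝓜.iterates am v₀ π₀ x α M ω ℓ).v - v₀) p := by
  induction ℓ with
  | zero => simp [totalError, iterates, utility]
  | succ ℓ ih =>
    have h_split : totalError (increment am v₀ π₀ x α M) M p (ℓ + 1) ω =
        totalError (increment am v₀ π₀ x α M) M p ℓ ω +
          blockError (increment am v₀ π₀ x α M ℓ ω) M (ℓ * M) p ω :=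
      Finset.sum_range_succ _ _
    rw [h_split, ih, blockError]
    simp only [increment, iterates, iteration_g, utility_sub]
    ring

variable {am v₀ π₀ x α M}

lemma isAccurate_iff {ω : 𝓜.Tape} {L : ℕ} : 𝓜.IsAccurate am v₀ π₀ x α M ω L ↔ ∀ ℓ < L, ∀ p,
    |totalError (increment am v₀ π₀ x α M) M p ℓ ω| ≤ (1 - 𝓜.γ) * α / 8 := by
  simp only [IsAccurate, totalError_increment]

lemma isAccurate_zero (ω : 𝓜.Tape) (L : ℕ) : 𝓜.IsAccurate am v₀ π₀ x 0 M ω L := by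
  have h_zero : ∀ ℓ, increment am v₀ π₀ x 0 M ℓ ω = 0 := fun ℓ => funext fun s => by
    simpa using increment_mem_Icc am v₀ π₀ x M le_rfl ℓ ω s
  simp [isAccurate_iff, totalError, h_zero, blockError, utility]

lemma exp_neg_sampleCount_le {δ : ℝ} (hδ : 0 < δ) (hδ1 : δ < 1) :
    2 * Real.exp (-(𝓜.sampleCount δ / (32 * 𝓜.iterCount))) ≤ δ / 𝓜.Atot := by
  have hL : (0 : ℝ) < 𝓜.iterCount := by exact_mod_cast 𝓜.iterCount_pos
  have hA : (1 : ℝ) ≤ 𝓜.Atot := by exact_mod_cast 𝓜.Atot_pos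
  have h_log_nonneg : 0 ≤ Real.log (2 * 𝓜.Atot / δ) :=
    Real.log_nonneg ((one_le_div hδ).2 (by linarith))
  have h_log : Real.log (2 * 𝓜.Atot / δ) ≤ 𝓜.sampleCount δ / (32 * 𝓜.iterCount) := by
    rw [le_div_iff₀ (by positivity)]
    refine le_trans ?_ (Nat.le_ceil _)
    nlinarith [mul_nonneg hL.le h_log_nonneg]
  calc 2 * Real.exp (-(𝓜.sampleCount δ / (32 * 𝓜.iterCount)))
      ≤ 2 * Real.exp (-Real.log (2 * 𝓜.Atot / δ)) := by gcongr
    _ = δ / 𝓜.Atot := by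
      rw [Real.exp_neg, Real.exp_log (by positivity), inv_div]
      field_simp

section Model

variable {Ω : Type*} [MeasurableSpace Ω] {μ : Measure Ω} [IsProbabilityMeasure μ]
  {X : 𝓜.Pair → ℕ → Ω → 𝓜.State} {δ : ℝ}

lemma IsGenerativeModel.measureReal_not_isAccurate_le (hX : 𝓜.IsGenerativeModel μ X)
    (hα : 0 ≤ α) (hδ : 0 < δ) (hδ1 : δ < 1) :
    μ.real {ω | ¬ 𝓜.IsAccurate am v₀ π₀ x α (𝓜.sampleCount δ) (tape X ω) 𝓜.iterCount} ≤ δ := by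
  rcases hα.eq_or_lt with rfl | hα0
  · simp [isAccurate_zero, hδ.le]
  set M := 𝓜.sampleCount δ
  set L := 𝓜.iterCount
  set c := (1 - 𝓜.γ) * α
  have hc : 0 < c := mul_pos 𝓜.one_sub_γ_pos hα0
  let inaccurate (p : 𝓜.Pair) : Set Ω :=
    {ω | ∃ ℓ ≤ L, c / 8 < |totalError (increment am v₀ π₀ x α M) M p ℓ (tape X ω)|}
  have h_sub : {ω | ¬ 𝓜.IsAccurate am v₀ π₀ x α M (tape X ω) L} ⊆
      ⋃ p, inaccurate p := fun ω hω => by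
    simp only [isAccurate_iff, Set.mem_ofPred_eq, not_forall, not_le] at hω
    obtain ⟨ℓ, hℓ, p, hp⟩ := hω
    exact Set.mem_iUnion.2 ⟨p, ℓ, hℓ.le, hp⟩
  have h_pair : ∀ p, μ.real (inaccurate p) ≤ δ / 𝓜.Atot := fun p => by
    refine ((hX.measureReal_exists_lt_abs_totalError_le (c := c) (𝓜.sampleCount_pos hδ hδ1)
      (dependsOnFirst_increment am v₀ π₀ x α M) (increment_mem_Icc am v₀ π₀ x M hα) hc p
      (by positivity) 𝓜.iterCount_pos).trans_eq ?_).trans (exp_neg_sampleCount_le hδ hδ1)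
    congr 3
    field_simp
    ring
  calc μ.real {ω | ¬ 𝓜.IsAccurate am v₀ π₀ x α M (tape X ω) L}
      ≤ ∑ p, μ.real (inaccurate p) :=
        (measureReal_mono h_sub).trans (measureReal_iUnion_fintype_le _)
    _ ≤ ∑ _p : 𝓜.Pair, δ / 𝓜.Atot := Finset.sum_le_sum fun p _ => h_pair p
    _ = δ := by
      have hA : (𝓜.Atot : ℝ) ≠ 0 := by exact_mod_cast 𝓜.Atot_pos.ne'
      rw [Finset.sum_const, Finset.card_univ, card_pair, nsmul_eq_mul, mul_div_cancel₀ _ hA]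

lemma IsGenerativeModel.le_measureReal_output (hX : 𝓜.IsGenerativeModel μ X)
    (ham : 𝓜.IsArgmaxRule am) {β : 𝓜.Pair → ℝ} (hδ : 0 < δ) (hδ1 : δ < 1) (hα : 0 ≤ α)
    (hx : ∀ p, 𝓜.utility v₀ p - β p ≤ x p ∧ x p ≤ 𝓜.utility v₀ p)
    (hv : ∀ s, 𝓜.optimalValue s - α ≤ v₀ s) (hπ : ∀ s, v₀ s ≤ 𝓜.policyOp π₀ v₀ s) :
    1 - δ ≤ μ.real {ω |
      let out := 𝓜.truncatedVRVI am v₀ π₀ x α δ (fun p j => X p j ω)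
      let v := out.1
      let π := out.2
      (∀ s, 0 ≤ 𝓜.optimalValue s - v s) ∧
      (∀ πs : 𝓜.Policy, 𝓜.IsOptimalPolicy πs →
        let ξ : 𝓜.State → ℝ := fun s => 𝓜.γ * ((1 - 𝓜.γ) / 4 * α + β ⟨s, πs s⟩)
        ∀ s, 𝓜.optimalValue s - v s ≤
          𝓜.γ ^ 𝓜.iterCount * α + ((1 - 𝓜.γ • 𝓜.policyMatrix πs)⁻¹.mulVec ξ) s) ∧
      (∀ s, v s ≤ 𝓜.policyOp π v s) ∧
      (β = 0 → ∀ s, 𝓜.optimalValue s - v s ≤ α / 2)} := by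
  let accurate : Set Ω :=
    {ω | 𝓜.IsAccurate am v₀ π₀ x α (𝓜.sampleCount δ) (tape X ω) 𝓜.iterCount}
  have h_accurate : 1 - δ ≤ μ.real accurate := by
    have h_cover : 1 ≤ μ.real accurate + μ.real accurateᶜ := by
      rw [← probReal_univ (μ := μ), ← Set.union_compl_self accurate]
      exact measureReal_union_le _ _
    have h_fail : μ.real accurateᶜ ≤ δ := hX.measureReal_not_isAccurate_le hα hδ hδ1
    linarith
  refine h_accurate.trans (measureReal_mono fun ω hω => ?_)
  have h_sub := IsAccurate.iterates_v_le_policyOp hω ham hα hx hπ le_rfl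
  refine ⟨fun s => sub_nonneg.2 (le_optimalValue h_sub s),
    fun πs hπs => IsAccurate.optimalValue_sub_iterates_v_le hω hα hx hv hπs le_rfl, h_sub,
    fun hβ => ?_⟩
  subst hβ
  exact IsAccurate.optimalValue_sub_iterates_v_le_half hω hα
    (fun p => le_antisymm (hx p).2 (by simpa using (hx p).1)) hv

end Model

end DMDP

/-! ### Specifications of programs -/

namespace RealRAM

/-- The cells at positions below `n` of the first 24 index arrays and real arrays; the program
below uses no others. -/
def workspace (n : ℕ) : Finset Cell :=
  (Finset.range 24 ×ˢ Finset.range n).image (fun q => Cell.idx q.1 q.2) ∪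
    (Finset.range 24 ×ˢ Finset.range n).image (fun q => Cell.real q.1 q.2)

@[simp] lemma idx_mem_workspace {n a i : ℕ} : Cell.idx a i ∈ workspace n ↔ a < 24 ∧ i < n := by
  simp [workspace]

@[simp] lemma real_mem_workspace {n a i : ℕ} : Cell.real a i ∈ workspace n ↔ a < 24 ∧ i < n := by
  simp [workspace]

lemma card_workspace_le (n : ℕ) : (workspace n).card ≤ 48 * n := by
  refine (Finset.card_union_le _ _).trans ?_
  refine (add_le_add Finset.card_image_le Finset.card_image_le).trans ?_
  simp only [Finset.card_product, Finset.card_range]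
  omega

/-- The index arrays that an instruction may change. -/
def Instr.iWrites : Instr → Finset ℕ
  | .iConst d _ | .iCopy d _ | .iSucc d | .query d _ _ => {d.arr}
  | _ => ∅

/-- The real arrays that an instruction may change. -/
def Instr.rWrites : Instr → Finset ℕ
  | .rConst d _ | .rCopy d _ | .rOp _ d _ _ | .rLog d _ => {d.arr}
  | _ => ∅

/-- The number of queries that an instruction makes. -/
def Instr.queryCount : Instr → ℕ
  | .query _ _ _ => 1
  | _ => 0

/-- The index arrays that a program may change. -/
def Prog.iWrites : Prog → Finset ℕ
  | .instr c => c.iWrites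
  | .seq p q | .cond _ p q => p.iWrites ∪ q.iWrites
  | .loop _ p => p.iWrites

/-- The real arrays that a program may change. -/
def Prog.rWrites : Prog → Finset ℕ
  | .instr c => c.rWrites
  | .seq p q | .cond _ p q => p.rWrites ∪ q.rWrites
  | .loop _ p => p.rWrites

/-- Whether a program contains no query. -/
def Prog.isQueryFree : Prog → Bool
  | .instr c => c.queryCount == 0
  | .seq p q | .cond _ p q => p.isQueryFree && q.isQueryFree
  | .loop _ p => p.isQueryFree

/-- `σ'` differs from `σ` at most where the program `p` may write, apart from the resources. -/
structure Frame (p : Prog) (σ σ' : Config) : Prop where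
  idx : ∀ a ∉ p.iWrites, σ'.idx a = σ.idx a
  real : ∀ a ∉ p.rWrites, σ'.real a = σ.real a
  asked : p.isQueryFree → σ'.asked = σ.asked

variable {O : ℕ → ℕ → ℕ → ℕ} {n : ℕ}

lemma Frame.charge_right {p : Prog} {σ σ' : Config} (h : Frame p σ σ') (cells : Finset Cell) :
    Frame p σ (σ'.charge cells) := ⟨h.idx, h.real, h.asked⟩

lemma Frame.charge_left {p : Prog} {σ σ' : Config} {cells : Finset Cell}
    (h : Frame p (σ.charge cells) σ') : Frame p σ σ' := ⟨h.idx, h.real, h.asked⟩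

lemma Frame.refl (p : Prog) (σ : Config) : Frame p σ σ :=
  ⟨fun _ _ => rfl, fun _ _ => rfl, fun _ => rfl⟩

lemma Frame.trans {p : Prog} {σ σ₁ σ₂ : Config} (h₁ : Frame p σ σ₁) (h₂ : Frame p σ₁ σ₂) :
    Frame p σ σ₂ where
  idx a ha := (h₂.idx a ha).trans (h₁.idx a ha)
  real a ha := (h₂.real a ha).trans (h₁.real a ha)
  asked h := (h₂.asked h).trans (h₁.asked h)

lemma Frame.seq_left {p q : Prog} {σ σ' : Config} (h : Frame p σ σ') :
    Frame (.seq p q) σ σ' where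
  idx a ha := h.idx a fun h' => ha (Finset.mem_union_left _ h')
  real a ha := h.real a fun h' => ha (Finset.mem_union_left _ h')
  asked h' := h.asked (Bool.and_elim_left h')

lemma Frame.seq_right {p q : Prog} {σ σ' : Config} (h : Frame q σ σ') :
    Frame (.seq p q) σ σ' where
  idx a ha := h.idx a fun h' => ha (Finset.mem_union_right _ h')
  real a ha := h.real a fun h' => ha (Finset.mem_union_right _ h')
  asked h' := h.asked (Bool.and_elim_right h')

lemma Frame.seq {p q : Prog} {σ σ₁ σ₂ : Config} (h₁ : Frame p σ σ₁) (h₂ : Frame q σ₁ σ₂) :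
    Frame (.seq p q) σ σ₂ := h₁.seq_left.trans h₂.seq_right

lemma update₂_apply {β : Type} (f : ℕ → ℕ → β) (a i : ℕ) (y : β) (b j : ℕ) :
    update₂ f a i y b j = if b = a ∧ j = i then y else f b j := by
  by_cases h : b = a
  · subst h
    by_cases h' : j = i
    · subst h'; simp [update₂]
    · simp [update₂, h']
  · simp [update₂, h]

lemma update₂_of_ne {β : Type} (f : ℕ → ℕ → β) {a b : ℕ} (i : ℕ) (y : β) (h : b ≠ a) :
    update₂ f a i y b = f b := by
  simp [update₂, h]

lemma frame_step (c : Instr) (σ : Config) : Frame (.instr c) σ (c.step O σ) := by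
  refine ⟨fun a ha => ?_, fun a ha => ?_, fun hq => ?_⟩
  · cases c <;> first
      | rfl
      | exact update₂_of_ne _ _ _ (by simpa [Prog.iWrites, Instr.iWrites] using ha)
  · cases c <;> first
      | rfl
      | exact update₂_of_ne _ _ _ (by simpa [Prog.rWrites, Instr.rWrites] using ha)
  · cases c <;> first
      | rfl
      | simp [Prog.isQueryFree, Instr.queryCount] at hq

/-- A conditional has the same frame as the sequential composition of its branches, and a loop
the same as its body, so the frame of an execution is found by composing frames. -/
lemma Exec.frame {p : Prog} {σ σ' : Config} (h : Exec O p σ σ') : Frame p σ σ' := by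
  induction h with
  | instr c σ => exact frame_step c σ
  | seq _ _ ih₁ ih₂ => exact ih₁.seq ih₂
  | @cond_true _ p q _ _ _ _ ih =>
    have := (ih.charge_left).seq_left (q := q)
    exact ⟨this.idx, this.real, this.asked⟩
  | @cond_false _ p q _ _ _ _ ih =>
    have := (ih.charge_left).seq_right (p := p)
    exact ⟨this.idx, this.real, this.asked⟩
  | loop_true _ _ _ ih₁ ih₂ =>
    exact Frame.trans ⟨ih₁.idx, ih₁.real, ih₁.asked⟩ ih₂
  | loop_false _ => exact (Frame.refl _ _).charge_right _

/-- Getting from `σ` to `σ'` takes at most `q` queries and `k` steps, and accesses only the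
workspace of size `n`. -/
structure WithinBudget (n q k : ℕ) (σ σ' : Config) : Prop where
  queries : σ'.queries ≤ σ.queries + q
  time : σ'.time ≤ σ.time + k
  touched : σ.touched ⊆ workspace n → σ'.touched ⊆ workspace n

lemma WithinBudget.refl (n : ℕ) (σ : Config) : WithinBudget n 0 0 σ σ := ⟨le_rfl, le_rfl, id⟩

lemma WithinBudget.trans {q₁ k₁ q₂ k₂ q k : ℕ} {σ σ₁ σ₂ : Config}
    (h₁ : WithinBudget n q₁ k₁ σ σ₁) (h₂ : WithinBudget n q₂ k₂ σ₁ σ₂)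
    (hq : q₁ + q₂ ≤ q := by omega) (hk : k₁ + k₂ ≤ k := by omega) :
    WithinBudget n q k σ σ₂ where
  queries := by have := h₁.queries; have := h₂.queries; omega
  time := by have := h₁.time; have := h₂.time; omega
  touched h := h₂.touched (h₁.touched h)

lemma withinBudget_charge {σ : Config} {cells : Finset Cell} (h : cells ⊆ workspace n) :
    WithinBudget n 0 1 σ (σ.charge cells) :=
  ⟨le_rfl, le_rfl, fun h' => Finset.union_subset h' h⟩

lemma withinBudget_step (c : Instr) {σ : Config} (h : c.cells σ ⊆ workspace n) :
    WithinBudget n c.queryCount 1 σ (c.step O σ) := by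
  refine ⟨?_, ?_, fun h' => Finset.union_subset (by cases c <;> exact h') h⟩ <;>
    cases c <;> exact le_rfl

/-- Started in `σ`, the program `p` halts within the budget in a configuration that satisfies
`Q`. -/
def Spec (O : ℕ → ℕ → ℕ → ℕ) (n : ℕ) (p : Prog) (q k : ℕ) (σ : Config) (Q : Config → Prop) :
    Prop :=
  ∃ σ', Exec O p σ σ' ∧ WithinBudget n q k σ σ' ∧ Q σ'

lemma Spec.mono {p : Prog} {q₁ k₁ q k : ℕ} {σ : Config} {Q₁ Q : Config → Prop}
    (h : Spec O n p q₁ k₁ σ Q₁) (hQ : ∀ σ', Frame p σ σ' → Q₁ σ' → Q σ')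
    (hq : q₁ ≤ q := by omega) (hk : k₁ ≤ k := by omega) : Spec O n p q k σ Q := by
  obtain ⟨σ', hexec, hbudget, hpost⟩ := h
  exact ⟨σ', hexec, hbudget.trans (.refl n σ') hq hk, hQ σ' hexec.frame hpost⟩

lemma Spec.seq {p₁ p₂ : Prog} {q₁ k₁ q₂ k₂ q k : ℕ} {σ : Config} {Q₁ Q : Config → Prop}
    (h₁ : Spec O n p₁ q₁ k₁ σ Q₁)
    (h₂ : ∀ σ₁, Frame p₁ σ σ₁ → Q₁ σ₁ → Spec O n p₂ q₂ k₂ σ₁ Q)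
    (hq : q₁ + q₂ ≤ q := by omega) (hk : k₁ + k₂ ≤ k := by omega) :
    Spec O n (.seq p₁ p₂) q k σ Q := by
  obtain ⟨σ₁, hexec₁, hbudget₁, hpost₁⟩ := h₁
  obtain ⟨σ₂, hexec₂, hbudget₂, hpost₂⟩ := h₂ σ₁ hexec₁.frame hpost₁
  exact ⟨σ₂, .seq hexec₁ hexec₂, hbudget₁.trans hbudget₂ hq hk, hpost₂⟩

lemma Spec.cond {b : Test} {p₁ p₂ : Prog} {q k : ℕ} {σ : Config} {Q : Config → Prop}
    (hb : b.cells σ ⊆ workspace n)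
    (h₁ : b.holds σ → Spec O n p₁ q k (σ.charge (b.cells σ)) Q)
    (h₂ : ¬ b.holds σ → Spec O n p₂ q k (σ.charge (b.cells σ)) Q) :
    Spec O n (.cond b p₁ p₂) q (k + 1) σ Q := by
  by_cases h : b.holds σ
  · obtain ⟨σ', hexec, hbudget, hpost⟩ := h₁ h
    exact ⟨σ', .cond_true h hexec, (withinBudget_charge hb).trans hbudget, hpost⟩
  · obtain ⟨σ', hexec, hbudget, hpost⟩ := h₂ h
    exact ⟨σ', .cond_false h hexec, (withinBudget_charge hb).trans hbudget, hpost⟩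

lemma Spec.loop {b : Test} {p : Prog} (q k : ℕ → ℕ) {σ : Config} (N : ℕ)
    (I : ℕ → Config → Prop) (h0 : I 0 σ)
    (hb : ∀ σ', Frame p σ σ' → b.cells σ' ⊆ workspace n)
    (htest : ∀ j ≤ N, ∀ σ', Frame p σ σ' → I j σ' → (b.holds σ' ↔ j < N))
    (hbody : ∀ j < N, ∀ σ', Frame p σ σ' → I j σ' → Spec O n p (q j) (k j) σ' (I (j + 1)))
    (hcharge : ∀ j σ' cells, I j σ' → I j (σ'.charge cells) := by exact fun _ _ _ h => h) :
    Spec O n (.loop b p) (∑ i ∈ Finset.range N, q i) (∑ i ∈ Finset.range N, (k i + 1) + 1) σ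
      (I N) := by
  suffices H : ∀ m j, j + m = N → ∀ σ', Frame p σ σ' → I j σ' →
      Spec O n (.loop b p) (∑ i ∈ Finset.Ico j N, q i) (∑ i ∈ Finset.Ico j N, (k i + 1) + 1) σ'
        (I N) by
    simpa only [Finset.range_eq_Ico] using H N 0 (zero_add N) σ (.refl p σ) h0
  intro m
  induction m with
  | zero =>
    rintro j rfl σ' hf hi
    exact ⟨_, .loop_false fun h => lt_irrefl _ ((htest _ le_rfl σ' hf hi).1 h),
      (withinBudget_charge (hb σ' hf)).trans (.refl n _) (by simp) (by simp), hcharge _ _ _ hi⟩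
  | succ m ih =>
    intro j hj σ' hf hi
    have hjN : j < N := by omega
    obtain ⟨σ₁, hexec₁, hbudget₁, hpost₁⟩ :=
      hbody j hjN _ (hf.charge_right (b.cells σ')) (hcharge _ _ _ hi)
    obtain ⟨σ₂, hexec₂, hbudget₂, hpost₂⟩ :=
      ih (j + 1) (by omega) σ₁ (hf.trans hexec₁.frame.charge_left) hpost₁
    rw [Finset.sum_eq_sum_Ico_succ_bot hjN, Finset.sum_eq_sum_Ico_succ_bot hjN]
    exact ⟨σ₂, .loop_true ((htest j hjN.le σ' hf hi).2 hjN) hexec₁ hexec₂,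
      (withinBudget_charge (hb σ' hf)).trans (hbudget₁.trans hbudget₂ le_rfl le_rfl), hpost₂⟩

/-- The sequential composition of a nonempty list of instructions. -/
def block : Instr → List Instr → Prog
  | c, [] => .instr c
  | c, c' :: l => .seq (.instr c) (block c' l)

/-- The configuration after executing a list of instructions. -/
def run (O : ℕ → ℕ → ℕ → ℕ) (σ : Config) (l : List Instr) : Config :=
  l.foldl (fun σ c => c.step O σ) σ

@[simp] lemma run_nil (σ : Config) : run O σ [] = σ := rfl

@[simp] lemma run_cons (σ : Config) (c : Instr) (l : List Instr) :
    run O σ (c :: l) = run O (c.step O σ) l := rfl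

/-- All accesses of a list of instructions, executed in order, are to the workspace. -/
def StaysInside (O : ℕ → ℕ → ℕ → ℕ) (n : ℕ) : Config → List Instr → Prop
  | _, [] => True
  | σ, c :: l => c.cells σ ⊆ workspace n ∧ StaysInside O n (c.step O σ) l

lemma Spec.block {c : Instr} {l : List Instr} {q k : ℕ} {σ : Config} {Q : Config → Prop}
    (hin : StaysInside O n σ (c :: l)) (hQ : Q (run O σ (c :: l)))
    (hq : ((c :: l).map Instr.queryCount).sum ≤ q := by decide)
    (hk : (c :: l).length ≤ k := by decide) :
    Spec O n (RealRAM.block c l) q k σ Q := by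
  induction l generalizing c σ q k with
  | nil =>
    exact ⟨_, .instr c σ, (withinBudget_step c hin.1).trans (.refl n _) (by simpa using hq)
      (by simpa using hk), hQ⟩
  | cons c' l ih =>
    have first : Spec O n (.instr c) c.queryCount 1 σ (fun σ' => σ' = c.step O σ) :=
      ⟨_, .instr c σ, withinBudget_step c hin.1, rfl⟩
    simp only [List.map_cons, List.sum_cons, List.length_cons] at hq hk ih
    refine first.seq (q₂ := q - c.queryCount) (k₂ := k - 1) ?_
    rintro _ - rfl
    exact ih hin.2 hQ (by omega) (by omega)

section Effects

variable (σ : Config) (d s t : Ref) (c : ℕ) (o : ROp) (a i : ℕ)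

@[simp] lemma step_iConst_idx : (Instr.step O σ (.iConst d c)).idx a i =
    if a = d.arr ∧ i = d.pos σ then c else σ.idx a i := update₂_apply _ _ _ _ _ _

@[simp] lemma step_iCopy_idx : (Instr.step O σ (.iCopy d s)).idx a i =
    if a = d.arr ∧ i = d.pos σ then s.iVal σ else σ.idx a i := update₂_apply _ _ _ _ _ _

@[simp] lemma step_iSucc_idx : (Instr.step O σ (.iSucc d)).idx a i =
    if a = d.arr ∧ i = d.pos σ then d.iVal σ + 1 else σ.idx a i := update₂_apply _ _ _ _ _ _

@[simp] lemma step_query_idx : (Instr.step O σ (.query d s t)).idx a i =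
    if a = d.arr ∧ i = d.pos σ then O (s.iVal σ) (t.iVal σ) (σ.asked (s.iVal σ) (t.iVal σ))
    else σ.idx a i := update₂_apply _ _ _ _ _ _

@[simp] lemma step_rConst_idx : (Instr.step O σ (.rConst d c)).idx = σ.idx := rfl

@[simp] lemma step_rCopy_idx : (Instr.step O σ (.rCopy d s)).idx = σ.idx := rfl

@[simp] lemma step_rOp_idx : (Instr.step O σ (.rOp o d s t)).idx = σ.idx := rfl

@[simp] lemma step_rConst_real : (Instr.step O σ (.rConst d c)).real a i =
    if a = d.arr ∧ i = d.pos σ then (c : ℝ) else σ.real a i := update₂_apply _ _ _ _ _ _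

@[simp] lemma step_rCopy_real : (Instr.step O σ (.rCopy d s)).real a i =
    if a = d.arr ∧ i = d.pos σ then s.rVal σ else σ.real a i := update₂_apply _ _ _ _ _ _

@[simp] lemma step_rOp_real : (Instr.step O σ (.rOp o d s t)).real a i =
    if a = d.arr ∧ i = d.pos σ then o.eval (s.rVal σ) (t.rVal σ) else σ.real a i :=
  update₂_apply _ _ _ _ _ _

@[simp] lemma step_rLog_real : (Instr.step O σ (.rLog d s)).real a i =
    if a = d.arr ∧ i = d.pos σ then Real.log (s.rVal σ) else σ.real a i :=
  update₂_apply _ _ _ _ _ _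

@[simp] lemma step_iConst_real : (Instr.step O σ (.iConst d c)).real = σ.real := rfl

@[simp] lemma step_iCopy_real : (Instr.step O σ (.iCopy d s)).real = σ.real := rfl

@[simp] lemma step_iSucc_real : (Instr.step O σ (.iSucc d)).real = σ.real := rfl

@[simp] lemma step_query_real : (Instr.step O σ (.query d s t)).real = σ.real := rfl

@[simp] lemma step_query_asked : (Instr.step O σ (.query d s t)).asked a i =
    if a = s.iVal σ ∧ i = t.iVal σ then σ.asked (s.iVal σ) (t.iVal σ) + 1 else σ.asked a i :=
  update₂_apply _ _ _ _ _ _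

@[simp] lemma step_rOp_asked : (Instr.step O σ (.rOp o d s t)).asked = σ.asked := rfl

@[simp] lemma step_iSucc_asked : (Instr.step O σ (.iSucc d)).asked = σ.asked := rfl

variable (cells : Finset Cell)

@[simp] lemma charge_idx : (σ.charge cells).idx = σ.idx := rfl

@[simp] lemma charge_real : (σ.charge cells).real = σ.real := rfl

end Effects

section References

variable (σ : Config) (a i : ℕ)

@[simp] lemma pos_scalar : (Ref.scalar a).pos σ = 0 := rfl

@[simp] lemma pos_entry : (Ref.entry a i).pos σ = σ.idx i 0 := rfl

@[simp] lemma arr_scalar : (Ref.scalar a).arr = a := rfl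

@[simp] lemma arr_entry : (Ref.entry a i).arr = a := rfl

@[simp] lemma iVal_scalar : (Ref.scalar a).iVal σ = σ.idx a 0 := rfl

@[simp] lemma iVal_entry : (Ref.entry a i).iVal σ = σ.idx a (σ.idx i 0) := rfl

@[simp] lemma rVal_scalar : (Ref.scalar a).rVal σ = σ.real a 0 := rfl

@[simp] lemma rVal_entry : (Ref.entry a i).rVal σ = σ.real a (σ.idx i 0) := rfl

@[simp] lemma iCells_scalar_subset :
    (Ref.scalar a).iCells σ ⊆ workspace n ↔ a < 24 ∧ 0 < n := by
  simp [Ref.iCells, Ref.aux]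

@[simp] lemma iCells_entry_subset : (Ref.entry a i).iCells σ ⊆ workspace n ↔
    (a < 24 ∧ σ.idx i 0 < n) ∧ i < 24 ∧ 0 < n := by
  simp [Ref.iCells, Ref.aux, Finset.insert_subset_iff]

@[simp] lemma rCells_scalar_subset :
    (Ref.scalar a).rCells σ ⊆ workspace n ↔ a < 24 ∧ 0 < n := by
  simp [Ref.rCells, Ref.aux]

@[simp] lemma rCells_entry_subset : (Ref.entry a i).rCells σ ⊆ workspace n ↔
    (a < 24 ∧ σ.idx i 0 < n) ∧ i < 24 ∧ 0 < n := by
  simp [Ref.rCells, Ref.aux, Finset.insert_subset_iff]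

@[simp] lemma iLt_cells_subset (s t : Ref) : (Test.iLt s t).cells σ ⊆ workspace n ↔
    s.iCells σ ⊆ workspace n ∧ t.iCells σ ⊆ workspace n := Finset.union_subset_iff

@[simp] lemma rLt_cells_subset (s t : Ref) : (Test.rLt s t).cells σ ⊆ workspace n ↔
    s.rCells σ ⊆ workspace n ∧ t.rCells σ ⊆ workspace n := Finset.union_subset_iff

@[simp] lemma iLt_holds (s t : Ref) : (Test.iLt s t).holds σ ↔ s.iVal σ < t.iVal σ := Iff.rfl

@[simp] lemma rLt_holds (s t : Ref) : (Test.rLt s t).holds σ ↔ s.rVal σ < t.rVal σ := Iff.rfl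

end References

end RealRAM

/-! ### The program -/

namespace RealRAM

/-! The index arrays of the program, the first three of which are part of the input; `pair` is the
position of the current pair `(state, action)`. -/

namespace IReg

@[simp] abbrev numStates : ℕ := 0
@[simp] abbrev numActions : ℕ := 1
@[simp] abbrev policy : ℕ := 2
@[simp] abbrev iterCount : ℕ := 3
@[simp] abbrev sampleCount : ℕ := 4
@[simp] abbrev iteration : ℕ := 5
@[simp] abbrev state : ℕ := 6
@[simp] abbrev action : ℕ := 7
@[simp] abbrev pair : ℕ := 8
@[simp] abbrev sample : ℕ := 9
@[simp] abbrev answer : ℕ := 10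
@[simp] abbrev bestAction : ℕ := 11

end IReg

/-! The real arrays of the program, the first six of which are part of the input. The vector `ĝ`
is not stored: it is `estimate - shift`, where `shift` is `0` in the first iteration and
`laterShift` from then on. -/

namespace RReg

@[simp] abbrev discount : ℕ := 0
@[simp] abbrev initialError : ℕ := 1
@[simp] abbrev confidence : ℕ := 2
@[simp] abbrev value : ℕ := 3
@[simp] abbrev reward : ℕ := 4
@[simp] abbrev offset : ℕ := 5
@[simp] abbrev estimate : ℕ := 6
@[simp] abbrev increment : ℕ := 7
@[simp] abbrev one : ℕ := 8
@[simp] abbrev counter : ℕ := 9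
@[simp] abbrev target : ℕ := 10
@[simp] abbrev threshold : ℕ := 11
@[simp] abbrev shift : ℕ := 12
@[simp] abbrev laterShift : ℕ := 13
@[simp] abbrev bestValue : ℕ := 14
@[simp] abbrev scratch : ℕ := 15
@[simp] abbrev sampleSum : ℕ := 16
@[simp] abbrev numPairs : ℕ := 17
@[simp] abbrev iterCount : ℕ := 18
@[simp] abbrev oneMinusDiscount : ℕ := 19
@[simp] abbrev newValue : ℕ := 20

end RReg

section Program

open IReg RReg

/-- Rounds `target` up, into the index array `d` and into `counter`. -/
def ceilLoop (d : ℕ) : Prog :=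
  .loop (.rLt (.scalar counter) (.scalar target))
    (block (.iSucc (.scalar d)) [.rOp .add (.scalar counter) (.scalar counter) (.scalar one)])

/-- Repeats `p` until all states have been visited. -/
def stateLoop (p : Prog) : Prog := .loop (.iLt (.scalar state) (.scalar numStates)) p

/-- Repeats `p` until all actions of the current state have been visited. -/
def actionLoop (p : Prog) : Prog := .loop (.iLt (.scalar action) (.entry numActions state)) p

/-- Computes `Atot`, which is not part of the input. -/
def countPairs : Prog :=
  stateLoop <|
  .seq (block (.iConst (.scalar action) 0) []) <|
  .seq (actionLoop (block (.rOp .add (.scalar numPairs) (.scalar numPairs) (.scalar one))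
    [.iSucc (.scalar action)]))
  (block (.iSucc (.scalar state)) [])

/-- Computes the threshold, the shift, and the real number that is rounded up to the number of
iterations. -/
def computeThreshold : Prog :=
  block (.rConst (.scalar one) 1) [
    .rOp .sub (.scalar oneMinusDiscount) (.scalar one) (.scalar discount),
    .rOp .mul (.scalar threshold) (.scalar oneMinusDiscount) (.scalar initialError),
    .rConst (.scalar scratch) 8,
    .rOp .div (.scalar laterShift) (.scalar threshold) (.scalar scratch),
    .rLog (.scalar target) (.scalar scratch),
    .rOp .div (.scalar target) (.scalar target) (.scalar oneMinusDiscount)]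

/-- Computes the real number that is rounded up to the number of samples. -/
def computeSampleTarget : Prog :=
  block (.rConst (.scalar scratch) 2) [
    .rOp .mul (.scalar scratch) (.scalar scratch) (.scalar numPairs),
    .rOp .div (.scalar scratch) (.scalar scratch) (.scalar confidence),
    .rLog (.scalar scratch) (.scalar scratch),
    .rConst (.scalar target) 256,
    .rOp .mul (.scalar target) (.scalar RReg.iterCount) (.scalar target),
    .rOp .mul (.scalar target) (.scalar target) (.scalar scratch),
    .rConst (.scalar counter) 0]

/-- Computes the number of iterations and the constants of `computeThreshold`. -/
def computeIterCount : Prog :=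
  .seq computeThreshold <|
  .seq (ceilLoop IReg.iterCount)
  (block (.rCopy (.scalar RReg.iterCount) (.scalar counter)) [])

/-- Computes the number of samples. -/
def computeSampleCount : Prog := .seq computeSampleTarget (ceilLoop sampleCount)

/-- Computes all the constants that the iterations use. -/
def setup : Prog := .seq computeIterCount <| .seq countPairs computeSampleCount

/-- Computes the action value of the current pair, into the real array `d`. -/
def evalPair (d : ℕ) : Prog :=
  block (.rOp .sub (.scalar scratch) (.entry estimate pair) (.scalar shift)) [
    .rOp .add (.scalar scratch) (.entry offset pair) (.scalar scratch),
    .rOp .mul (.scalar scratch) (.scalar discount) (.scalar scratch),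
    .rOp .add (.scalar d) (.entry reward pair) (.scalar scratch)]

/-- Compares the current action with the best one so far, and moves on to the next action. -/
def compareAction : Prog :=
  .seq (evalPair scratch) <|
  .seq (.cond (.rLt (.scalar bestValue) (.scalar scratch))
    (block (.rCopy (.scalar bestValue) (.scalar scratch))
      [.iCopy (.scalar bestAction) (.scalar action)])
    (block (.rCopy (.scalar bestValue) (.scalar bestValue)) []))
  (block (.iSucc (.scalar action)) [.iSucc (.scalar pair)])

/-- Determines the best action of the current state. -/
def chooseAction : Prog :=
  .seq (evalPair bestValue) <|
  .seq (block (.iConst (.scalar bestAction) 0) [.iConst (.scalar action) 0])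
  (actionLoop compareAction)

/-- Truncates the best action value. -/
def truncateValue : Prog :=
  .seq (block (.rOp .add (.scalar newValue) (.entry value state) (.scalar threshold)) [])
  (.cond (.rLt (.scalar bestValue) (.scalar newValue))
    (block (.rCopy (.scalar newValue) (.scalar bestValue)) [])
    (block (.rCopy (.scalar newValue) (.scalar newValue)) []))

/-- Adopts the new value and the best action unless the value would decrease. -/
def raiseValue : Prog :=
  .cond (.rLt (.scalar newValue) (.entry value state))
    (block (.rConst (.entry increment state) 0) [])
    (block (.rOp .sub (.entry increment state) (.scalar newValue) (.entry value state)) [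
      .rCopy (.entry value state) (.scalar newValue),
      .iCopy (.entry policy state) (.scalar bestAction)])

/-- Updates the value and the policy at the current state, and moves on to the next state. -/
def updateState : Prog :=
  .seq chooseAction <| .seq truncateValue <| .seq raiseValue <| block (.iSucc (.scalar state)) []

/-- Updates the values and the policy. -/
def updateStates : Prog :=
  .seq (block (.iConst (.scalar state) 0) [.iConst (.scalar pair) 0]) (stateLoop updateState)

/-- Sums the increments at the answers of the generative model. -/
def sampleLoop : Prog :=
  .loop (.iLt (.scalar sample) (.scalar sampleCount))
    (block (.query (.scalar answer) (.scalar state) (.scalar action)) [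
      .rOp .add (.scalar sampleSum) (.scalar sampleSum) (.entry increment answer),
      .iSucc (.scalar sample)])

/-- Updates the estimate of the current pair, and moves on to the next pair. After `setup`,
`counter` holds the number of samples as a real number. -/
def samplePair : Prog :=
  .seq (block (.rConst (.scalar sampleSum) 0) [.iConst (.scalar sample) 0]) <|
  .seq sampleLoop
  (block (.rOp .div (.scalar sampleSum) (.scalar sampleSum) (.scalar counter)) [
    .rOp .add (.entry estimate pair) (.entry estimate pair) (.scalar sampleSum),
    .iSucc (.scalar action),
    .iSucc (.scalar pair)])

/-- Updates the estimates of the pairs at the current state, and moves on to the next state. -/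
def sampleState : Prog :=
  .seq (block (.iConst (.scalar action) 0) []) <|
  .seq (actionLoop samplePair)
  (block (.iSucc (.scalar state)) [])

/-- Updates all estimates. -/
def updateEstimates : Prog :=
  .seq (block (.iConst (.scalar state) 0) [.iConst (.scalar pair) 0]) (stateLoop sampleState)

/-- One iteration of the algorithm. -/
def iterate : Prog :=
  .seq updateStates <|
  .seq updateEstimates <|
  block (.rCopy (.scalar shift) (.scalar laterShift)) [.iSucc (.scalar IReg.iteration)]

/-- The whole program. -/
def program : Prog :=
  .seq setup (.loop (.iLt (.scalar IReg.iteration) (.scalar IReg.iterCount)) iterate)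

end Program

variable {O : ℕ → ℕ → ℕ → ℕ} {n : ℕ}

lemma ceilLoop_spec (hn : 0 < n) {d : ℕ} (hd : d < 24) {t : ℝ} {σ : Config}
    (hone : σ.real RReg.one 0 = 1) (hcounter : σ.real RReg.counter 0 = 0)
    (htarget : σ.real RReg.target 0 = t) (h0 : σ.idx d 0 = 0) :
    Spec O n (ceilLoop d) 0 (3 * ⌈t⌉₊ + 1) σ fun σ' =>
      σ'.idx d 0 = ⌈t⌉₊ ∧ σ'.real RReg.counter 0 = ⌈t⌉₊ := by
  refine (Spec.loop (fun _ => 0) (fun _ => 2) ⌈t⌉₊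
    (fun j σ' => σ'.idx d 0 = j ∧ σ'.real RReg.counter 0 = j) (by simp [h0, hcounter]) ?_ ?_
    ?_).mono (fun _ _ h => h) (by simp) (by simp; omega)
  · intro σ' _
    simp [hn]
  · intro j _ σ' hf hi
    have hframe := hf.real RReg.target (by simp [block, Prog.rWrites, Instr.rWrites])
    simp [hi, hframe, htarget, Nat.lt_ceil]
  · intro j _ σ' hf hi
    have hframe := hf.real RReg.one (by simp [block, Prog.rWrites, Instr.rWrites])
    refine Spec.block ?_ ?_ (by simp [Instr.queryCount]) (by simp)
    · simp [StaysInside, Instr.cells, Finset.union_subset_iff, hn, hd]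
    · simp [hi, ROp.eval, hframe, hone]

end RealRAM

/-! ### Loops over states and pairs -/

/-- The least index below `k` at which `F` is maximal. -/
def firstMax (F : ℕ → ℝ) : ℕ → ℕ
  | 0 => 0
  | k + 1 => if F (firstMax F k) < F k then k else firstMax F k

lemma firstMax_lt (F : ℕ → ℝ) {k : ℕ} (hk : 0 < k) : firstMax F k < k := by
  induction k with
  | zero => exact absurd hk (lt_irrefl 0)
  | succ k ih =>
    rw [firstMax]
    split_ifs
    · omega
    · rcases k.eq_zero_or_pos with rfl | h
      · simp [firstMax]
      · have := ih h; omega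

lemma le_firstMax (F : ℕ → ℝ) {j k : ℕ} (hj : j < k) : F j ≤ F (firstMax F k) := by
  induction k with
  | zero => omega
  | succ k ih =>
    rw [firstMax]
    rcases Nat.lt_succ_iff_lt_or_eq.1 hj with hjk | rfl <;> split_ifs with h
    · exact (ih hjk).trans h.le
    · exact ih hjk
    · exact le_rfl
    · exact not_lt.1 h

namespace DMDP

open RealRAM

variable (𝓜 : DMDP)

lemma toArray_of_lt {β : Type} [Zero β] {k : ℕ} (f : Fin k → β) {i : ℕ} (h : i < k) :
    toArray f i = f ⟨i, h⟩ := dif_pos h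

/-- The rule that selects the first maximizer. -/
def firstMaximizer : 𝓜.SelectionRule := fun s f =>
  ⟨firstMax (toArray f) (𝓜.numActions s), firstMax_lt _ (𝓜.numActions_pos s)⟩

lemma toArray_firstMax (s : 𝓜.State) (f : 𝓜.Action s → ℝ) :
    toArray f (firstMax (toArray f) (𝓜.numActions s)) = f (𝓜.firstMaximizer s f) :=
  toArray_of_lt _ _

lemma isArgmaxRule_firstMaximizer : 𝓜.IsArgmaxRule 𝓜.firstMaximizer := fun s f a => by
  rw [← 𝓜.toArray_firstMax s f, ← toArray_of_lt f a.2]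
  exact le_firstMax (toArray f) a.2

/-- The position of the first pair of the state `k`, in the order of `pairArray`. -/
def offset (k : ℕ) : ℕ := ∑ i ∈ Finset.range k, toArray 𝓜.numActions i

lemma offset_zero : 𝓜.offset 0 = 0 := Finset.sum_range_zero _

lemma offset_succ (s : 𝓜.State) : 𝓜.offset (s + 1) = 𝓜.offset s + 𝓜.numActions s := by
  rw [offset, Finset.sum_range_succ, toArray_of_lt _ s.2, offset]

lemma offset_numStates : 𝓜.offset 𝓜.numStates = 𝓜.Atot := by
  rw [offset, Finset.sum_range, Atot]
  exact Finset.sum_congr rfl fun s _ => toArray_of_lt _ s.2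

/-- The position of a pair, in the order of `pairArray`. -/
def position (p : 𝓜.Pair) : ℕ := finSigmaFinEquiv p

lemma position_lt (p : 𝓜.Pair) : 𝓜.position p < 𝓜.Atot := (finSigmaFinEquiv p).2

lemma position_injective : Function.Injective 𝓜.position := fun _ _ h =>
  finSigmaFinEquiv.injective (Fin.ext h)

lemma position_eq (s : 𝓜.State) (a : 𝓜.Action s) : 𝓜.position ⟨s, a⟩ = 𝓜.offset s + a := by
  rw [position, finSigmaFinEquiv_apply, offset, Finset.sum_range]
  congr 1
  refine Finset.sum_congr rfl fun i _ => ?_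
  rw [toArray_of_lt _ (i.2.trans s.2)]
  rfl

lemma pairArray_position (f : 𝓜.Pair → ℝ) (p : 𝓜.Pair) :
    𝓜.pairArray f (𝓜.position p) = f p := by
  have h : 𝓜.position p < ∑ s, 𝓜.numActions s := 𝓜.position_lt p
  rw [pairArray, toArray_of_lt _ h]
  exact congrArg f (finSigmaFinEquiv.symm_apply_apply p)

lemma numStates_le_Atot : 𝓜.numStates ≤ 𝓜.Atot := by
  calc 𝓜.numStates = ∑ _s : 𝓜.State, 1 := by simp
    _ ≤ 𝓜.Atot := Finset.sum_le_sum fun s _ => 𝓜.numActions_pos s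

lemma state_lt_Atot (s : 𝓜.State) : (s : ℕ) < 𝓜.Atot := s.2.trans_le 𝓜.numStates_le_Atot

lemma sum_states_le (a b : ℕ) :
    ∑ i ∈ Finset.range 𝓜.numStates, (a + b * toArray 𝓜.numActions i) ≤ (a + b) * 𝓜.Atot := by
  calc ∑ i ∈ Finset.range 𝓜.numStates, (a + b * toArray 𝓜.numActions i)
      = 𝓜.numStates * a + b * 𝓜.offset 𝓜.numStates := by
        rw [Finset.sum_add_distrib, ← Finset.mul_sum, Finset.sum_const, Finset.card_range,
          smul_eq_mul, offset]
    _ ≤ 𝓜.Atot * a + b * 𝓜.Atot := by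
        rw [offset_numStates]
        gcongr
        exact 𝓜.numStates_le_Atot
    _ = (a + b) * 𝓜.Atot := by ring

variable {𝓜} {O : ℕ → ℕ → ℕ → ℕ} {σ : Config}

lemma stateLoop_spec {p : Prog} (q a b : ℕ) (I : ℕ → Config → Prop)
    (hS : σ.idx IReg.numStates 0 = 𝓜.numStates) (hs : σ.idx IReg.state 0 = 0) (h0 : I 0 σ)
    (hbody : ∀ (s : 𝓜.State) (σ' : Config), Frame p σ σ' → σ'.idx IReg.state 0 = s → I s σ' →
      Spec O 𝓜.Atot p (q * 𝓜.numActions s) (a + b * 𝓜.numActions s) σ' fun σ'' =>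
        σ''.idx IReg.state 0 = s + 1 ∧ I (s + 1) σ'')
    (hcharge : ∀ k σ' cells, I k σ' → I k (σ'.charge cells) := by exact fun _ _ _ h => h)
    (hp : IReg.numStates ∉ p.iWrites := by decide) :
    Spec O 𝓜.Atot (stateLoop p) (q * 𝓜.Atot) ((a + 1 + b) * 𝓜.Atot + 1) σ (I 𝓜.numStates) := by
  refine (Spec.loop (fun k => q * toArray 𝓜.numActions k)
    (fun k => a + b * toArray 𝓜.numActions k) 𝓜.numStates
    (fun k σ' => σ'.idx IReg.state 0 = k ∧ I k σ') ⟨hs, h0⟩ ?_ ?_ ?_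
    (fun _ _ _ h => ⟨h.1, hcharge _ _ _ h.2⟩)).mono (fun _ _ h => h.2) ?_ ?_
  · simp [𝓜.Atot_pos]
  · intro k _ σ' hf hi
    simp [hi, hf.idx _ hp, hS]
  · intro k hk σ' hf hi
    simpa [toArray_of_lt _ hk] using hbody ⟨k, hk⟩ σ' hf hi.1 hi.2
  · rw [← Finset.mul_sum, ← offset, offset_numStates]
  · simpa only [add_right_comm _ _ 1] using Nat.add_le_add_right (𝓜.sum_states_le (a + 1) b) 1

lemma actionLoop_spec {p : Prog} {s : 𝓜.State} (q c : ℕ) (I : ℕ → Config → Prop)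
    (hA : σ.idx IReg.numActions = toArray 𝓜.numActions) (hs : σ.idx IReg.state 0 = s)
    (ha : σ.idx IReg.action 0 = 0) (h0 : I 0 σ)
    (hbody : ∀ (a : 𝓜.Action s) (σ' : Config), Frame p σ σ' → σ'.idx IReg.action 0 = a → I a σ' →
      Spec O 𝓜.Atot p q c σ' fun σ'' => σ''.idx IReg.action 0 = a + 1 ∧ I (a + 1) σ'')
    (hcharge : ∀ k σ' cells, I k σ' → I k (σ'.charge cells) := by exact fun _ _ _ h => h)
    (hp : IReg.numActions ∉ p.iWrites := by decide) (hp' : IReg.state ∉ p.iWrites := by decide) :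
    Spec O 𝓜.Atot (actionLoop p) (q * 𝓜.numActions s) ((c + 1) * 𝓜.numActions s + 1) σ
      (I (𝓜.numActions s)) := by
  refine (Spec.loop (fun _ => q) (fun _ => c) (𝓜.numActions s)
    (fun k σ' => σ'.idx IReg.action 0 = k ∧ I k σ') ⟨ha, h0⟩ ?_ ?_
    (fun a hlt σ' hf hi => hbody ⟨a, hlt⟩ σ' hf hi.1 hi.2)
    (fun _ _ _ h => ⟨h.1, hcharge _ _ _ h.2⟩)).mono (fun _ _ h => h.2) ?_ ?_
  · intro σ' hf
    simp [𝓜.Atot_pos, hf.idx _ hp', hs, 𝓜.state_lt_Atot]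
  · intro k _ σ' hf hi
    simp [hi, hf.idx _ hp, hf.idx _ hp', hs, hA, toArray_of_lt]
  · simp [mul_comm]
  · simp [mul_comm]

lemma countPairs_spec (hS : σ.idx IReg.numStates 0 = 𝓜.numStates)
    (hA : σ.idx IReg.numActions = toArray 𝓜.numActions) (hs : σ.idx IReg.state 0 = 0)
    (hone : σ.real RReg.one 0 = 1) (h0 : σ.real RReg.numPairs 0 = 0) :
    Spec O 𝓜.Atot countPairs 0 (8 * 𝓜.Atot + 1) σ fun σ' => σ'.real RReg.numPairs 0 = 𝓜.Atot := by
  have hn := 𝓜.Atot_pos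
  refine (stateLoop_spec 0 3 3 (fun k σ' => σ'.real RReg.numPairs 0 = 𝓜.offset k) hS hs
    (by simp [h0, offset_zero]) fun s σ₁ f₁ hs hi => ?_).mono
    (fun _ _ h => by rw [h, offset_numStates])
  refine Spec.seq (Q₁ := fun σ' => σ'.idx IReg.action 0 = 0) (k₁ := 1) (q₁ := 0) (q₂ := 0)
    (k₂ := 3 * 𝓜.numActions s + 2)
    (Spec.block (by simp [StaysInside, Instr.cells, hn]) (by simp)) fun σ₂ f₂ ha => ?_
  refine (actionLoop_spec (s := s) 0 2 (fun j σ' => σ'.real RReg.numPairs 0 = 𝓜.offset s + j)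
      ?_ ?_ ha ?_ fun a σ₃ f₃ ha' hi' => ?_).seq (q₂ := 0) (k₂ := 1) fun σ₄ f₄ hnum => ?_
  · simp (disch := decide) [f₂.idx, f₁.idx, hA]
  · simp (disch := decide) [f₂.idx, hs]
  · simp (disch := decide) [f₂.real, hi]
  · refine Spec.block ?_ ?_
    · simp [StaysInside, Instr.cells, Finset.union_subset_iff, hn]
    · simp (disch := decide) [ROp.eval, ha', hi', f₃.real, f₂.real, f₁.real, hone, add_assoc]
  · refine Spec.block ?_ ?_
    · simp [StaysInside, Instr.cells, hn]
    · simp (disch := decide) [f₄.idx, f₂.idx, hs, hnum, offset_succ]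

end DMDP

/-! ### Value updates -/

namespace RealRAM

/-- The value that `evalPair` computes when the current pair is at position `i`. -/
def Config.actionValueAt (σ : Config) (i : ℕ) : ℝ :=
  σ.real RReg.reward i + σ.real RReg.discount 0 *
    (σ.real RReg.offset i + (σ.real RReg.estimate i - σ.real RReg.shift 0))

lemma Frame.actionValueAt_eq {p : Prog} {σ σ' : Config} (hf : Frame p σ σ')
    (hp : Disjoint {RReg.reward, RReg.discount, RReg.offset, RReg.estimate, RReg.shift} p.rWrites) :
    σ'.actionValueAt = σ.actionValueAt := by
  simp only [Finset.disjoint_insert_left, Finset.disjoint_singleton_left] at hp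
  obtain ⟨hr, hd, ho, he, hs⟩ := hp
  funext i
  rw [Config.actionValueAt, hf.real _ hr, hf.real _ hd, hf.real _ ho, hf.real _ he, hf.real _ hs,
    Config.actionValueAt]

variable {O : ℕ → ℕ → ℕ → ℕ} {n : ℕ} {σ : Config}

lemma evalPair_spec {d i : ℕ} (hd : d < 24) (hi : i < n) (hpair : σ.idx IReg.pair 0 = i) :
    Spec O n (evalPair d) 0 4 σ fun σ' => σ'.real d 0 = σ.actionValueAt i := by
  have hn : 0 < n := i.zero_le.trans_lt hi
  refine Spec.block ?_ ?_ (by simp [Instr.queryCount]) (by simp)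
  · simp [StaysInside, Instr.cells, Finset.union_subset_iff, hn, hd, hi, hpair]
  · simp [ROp.eval, Config.actionValueAt, hpair]

lemma compareAction_spec {F : ℕ → ℝ} {j i : ℕ} (hi : i < n) (hpair : σ.idx IReg.pair 0 = i)
    (haction : σ.idx IReg.action 0 = j) (hF : σ.actionValueAt i = F j)
    (hbest : σ.idx IReg.bestAction 0 = firstMax F j)
    (hvalue : σ.real RReg.bestValue 0 = F (firstMax F j)) :
    Spec O n compareAction 0 9 σ fun σ' =>
      σ'.idx IReg.action 0 = j + 1 ∧ σ'.idx IReg.pair 0 = i + 1 ∧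
        σ'.idx IReg.bestAction 0 = firstMax F (j + 1) ∧
        σ'.real RReg.bestValue 0 = F (firstMax F (j + 1)) := by
  have hn : 0 < n := i.zero_le.trans_lt hi
  refine (evalPair_spec (by decide) hi hpair).seq (q₂ := 0) (k₂ := 5) fun σ₁ f₁ hscratch => ?_
  rw [hF] at hscratch
  have hbest₁ : σ₁.idx IReg.bestAction 0 = firstMax F j := by simp (disch := decide) [f₁.idx, hbest]
  have hvalue₁ : σ₁.real RReg.bestValue 0 = F (firstMax F j) := by
    simp (disch := decide) [f₁.real, hvalue]
  refine Spec.seq (q₁ := 0) (q₂ := 0) (k₂ := 2)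
    (Q₁ := fun σ' => σ'.idx IReg.bestAction 0 = firstMax F (j + 1) ∧
      σ'.real RReg.bestValue 0 = F (firstMax F (j + 1)))
    (Spec.cond (k := 2) (by simp [hn]) (fun hlt => Spec.block ?_ ?_) fun hlt => Spec.block ?_ ?_)
    fun σ₂ f₂ hmax => Spec.block ?_ ?_
  · simp [StaysInside, Instr.cells, Finset.union_subset_iff, hn]
  · simp only [rLt_holds, rVal_scalar, hvalue₁, hscratch] at hlt
    simp (disch := decide) [firstMax, hlt, hscratch, f₁.idx, haction]
  · simp [StaysInside, Instr.cells, hn]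
  · simp only [rLt_holds, rVal_scalar, hvalue₁, hscratch] at hlt
    simp [firstMax, hlt, hbest₁, hvalue₁]
  · simp [StaysInside, Instr.cells, hn]
  · simp (disch := decide) [f₂.idx, f₁.idx, haction, hpair, hmax]

end RealRAM

namespace DMDP

open RealRAM

variable {𝓜 : DMDP} {O : ℕ → ℕ → ℕ → ℕ} {σ : Config}

lemma offset_add_lt (s : 𝓜.State) (a : 𝓜.Action s) : 𝓜.offset s + a < 𝓜.Atot := by
  simpa only [position_eq] using 𝓜.position_lt ⟨s, a⟩

lemma chooseAction_spec {s : 𝓜.State} (f : 𝓜.Action s → ℝ)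
    (hA : σ.idx IReg.numActions = toArray 𝓜.numActions) (hs : σ.idx IReg.state 0 = s)
    (hpair : σ.idx IReg.pair 0 = 𝓜.offset s)
    (hf : ∀ a : 𝓜.Action s, σ.actionValueAt (𝓜.offset s + a) = f a) :
    Spec O 𝓜.Atot chooseAction 0 (10 * 𝓜.numActions s + 7) σ fun σ' =>
      σ'.idx IReg.pair 0 = 𝓜.offset (s + 1) ∧
        σ'.idx IReg.bestAction 0 = 𝓜.firstMaximizer s f ∧
        σ'.real RReg.bestValue 0 = f (𝓜.firstMaximizer s f) := by
  have hn := 𝓜.Atot_pos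
  have hF (a : 𝓜.Action s) : σ.actionValueAt (𝓜.offset s + a) = toArray f a := by
    rw [hf, toArray_of_lt f a.2]
  refine (evalPair_spec (by decide) (𝓜.offset_add_lt s ⟨0, 𝓜.numActions_pos s⟩) hpair).seq
    (q₂ := 0) (k₂ := 10 * 𝓜.numActions s + 3) fun σ₁ f₁ hbest => ?_
  refine Spec.seq (q₁ := 0) (k₁ := 2) (q₂ := 0) (k₂ := 10 * 𝓜.numActions s + 1)
    (Q₁ := fun σ' => σ'.idx IReg.bestAction 0 = 0 ∧ σ'.idx IReg.action 0 = 0)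
    (Spec.block (by simp [StaysInside, Instr.cells, hn]) (by simp)) fun σ₂ f₂ h₂ => ?_
  refine (actionLoop_spec 0 9 (fun j σ' => σ'.idx IReg.pair 0 = 𝓜.offset s + j ∧
      σ'.idx IReg.bestAction 0 = firstMax (toArray f) j ∧
      σ'.real RReg.bestValue 0 = toArray f (firstMax (toArray f) j))
    ?_ ?_ h₂.2 ⟨?_, h₂.1, ?_⟩ fun a σ₃ f₃ haction h₃ => ?_).mono fun σ' _ h => ⟨?_, h.2.1, ?_⟩
  · simp (disch := decide) [f₂.idx, f₁.idx, hA]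
  · simp (disch := decide) [f₂.idx, f₁.idx, hs]
  · simp (disch := decide) [f₂.idx, f₁.idx, hpair]
  · rw [f₂.real _ (by decide), hbest, firstMax]
    exact hF ⟨0, 𝓜.numActions_pos s⟩
  · refine compareAction_spec (𝓜.offset_add_lt s a) h₃.1 haction ?_ h₃.2.1 h₃.2.2
    rw [f₃.actionValueAt_eq (by decide), f₂.actionValueAt_eq (by decide),
      f₁.actionValueAt_eq (by decide)]
    exact hF a
  · rw [h.1, offset_succ]
  · rw [h.2.2, toArray_firstMax]

end DMDP

namespace RealRAM

variable {O : ℕ → ℕ → ℕ → ℕ} {n s : ℕ} {σ : Config}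

lemma truncateValue_spec (hsn : s < n) (hs : σ.idx IReg.state 0 = s) :
    Spec O n truncateValue 0 3 σ fun σ' => σ'.real RReg.newValue 0 =
      min (σ.real RReg.bestValue 0) (σ.real RReg.value s + σ.real RReg.threshold 0) := by
  have hn : 0 < n := s.zero_le.trans_lt hsn
  refine Spec.seq (q₁ := 0) (k₁ := 1) (q₂ := 0) (k₂ := 2)
    (Q₁ := fun σ' =>
      σ'.real RReg.newValue 0 = σ.real RReg.value s + σ.real RReg.threshold 0)
    (Spec.block ?_ ?_) fun σ₁ f₁ h₁ => ?_
  · simp [StaysInside, Instr.cells, Finset.union_subset_iff, hn, hs, hsn]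
  · simp [ROp.eval, hs]
  have hbest := congrFun (f₁.real RReg.bestValue (by decide)) 0
  refine Spec.cond (k := 1) (by simp [hn]) (fun hlt => Spec.block ?_ ?_) fun hlt =>
    Spec.block ?_ ?_
  · simp [StaysInside, Instr.cells, Finset.union_subset_iff, hn]
  · simp only [rLt_holds, rVal_scalar, h₁, hbest] at hlt
    simp [hbest, hlt.le]
  · simp [StaysInside, Instr.cells, hn]
  · simp only [rLt_holds, rVal_scalar, h₁, hbest, not_lt] at hlt
    simp [h₁, hlt]

lemma raiseValue_spec (hsn : s < n) (hs : σ.idx IReg.state 0 = s) :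
    Spec O n raiseValue 0 4 σ fun σ' =>
      σ'.real RReg.value s = max (σ.real RReg.value s) (σ.real RReg.newValue 0) ∧
      σ'.idx IReg.policy s = (if σ.real RReg.value s ≤ σ.real RReg.newValue 0
        then σ.idx IReg.bestAction 0 else σ.idx IReg.policy s) ∧
      σ'.real RReg.increment s = σ'.real RReg.value s - σ.real RReg.value s ∧
      ∀ i ≠ s, σ'.real RReg.value i = σ.real RReg.value i ∧
        σ'.idx IReg.policy i = σ.idx IReg.policy i ∧
        σ'.real RReg.increment i = σ.real RReg.increment i := by
  have hn : 0 < n := s.zero_le.trans_lt hsn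
  refine Spec.cond (k := 3) ?_ (fun hlt => Spec.block ?_ ?_) fun hlt => Spec.block ?_ ?_
  · simp [hn, hs, hsn]
  · simp [StaysInside, Instr.cells, hn, hs, hsn]
  · simp only [rLt_holds, rVal_scalar, rVal_entry, hs] at hlt
    simp +contextual [hs, hlt.le, hlt]
  · simp [StaysInside, Instr.cells, Finset.union_subset_iff, hn, hs, hsn]
  · simp only [rLt_holds, rVal_scalar, rVal_entry, hs, not_lt] at hlt
    simp +contextual [ROp.eval, hs, hlt]

end RealRAM

namespace DMDP

open RealRAM

variable {𝓜 : DMDP} {O : ℕ → ℕ → ℕ → ℕ} {σ : Config} {x : 𝓜.Pair → ℝ} {α : ℝ}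
  {M ℓ : ℕ} {ω : 𝓜.Tape} {I J : 𝓜.Iterate}

lemma firstMaximizer_eq_iSup (s : 𝓜.State) (f : 𝓜.Action s → ℝ) :
    f (𝓜.firstMaximizer s f) = ⨆ a, f a :=
  le_antisymm (le_ciSup (Set.finite_range f).bddAbove _)
    (ciSup_le fun a => 𝓜.isArgmaxRule_firstMaximizer s f a)

lemma updateState_spec {s : 𝓜.State} (hJ : J = 𝓜.iteration 𝓜.firstMaximizer x α M ω ℓ I)
    (hA : σ.idx IReg.numActions = toArray 𝓜.numActions) (hs : σ.idx IReg.state 0 = s)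
    (hpair : σ.idx IReg.pair 0 = 𝓜.offset s)
    (hQ : ∀ a : 𝓜.Action s, σ.actionValueAt (𝓜.offset s + a) = 𝓜.actionValue x I ⟨s, a⟩)
    (hthreshold : σ.real RReg.threshold 0 = (1 - 𝓜.γ) * α)
    (hv : σ.real RReg.value s = I.v s) (hπ : σ.idx IReg.policy s = I.π s) :
    Spec O 𝓜.Atot updateState 0 (15 + 10 * 𝓜.numActions s) σ fun σ' =>
      σ'.idx IReg.state 0 = s + 1 ∧ σ'.idx IReg.pair 0 = 𝓜.offset (s + 1) ∧
      (σ'.real RReg.value s = J.v s ∧ σ'.idx IReg.policy s = J.π s ∧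
        σ'.real RReg.increment s = J.v s - I.v s) ∧
      ∀ i ≠ (s : ℕ), σ'.real RReg.value i = σ.real RReg.value i ∧
        σ'.idx IReg.policy i = σ.idx IReg.policy i ∧
        σ'.real RReg.increment i = σ.real RReg.increment i := by
  have hsn := 𝓜.state_lt_Atot s
  refine (chooseAction_spec (fun a => 𝓜.actionValue x I ⟨s, a⟩) hA hs hpair hQ).seq (q₂ := 0)
    (k₂ := 8) fun σ₁ f₁ ⟨hpair₁, hbest₁, hmax₁⟩ => ?_
  have hs₁ : σ₁.idx IReg.state 0 = s := by simp (disch := decide) [f₁.idx, hs]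
  refine (truncateValue_spec hsn hs₁).seq (q₂ := 0) (k₂ := 5) fun σ₂ f₂ hnew₂ => ?_
  have hs₂ : σ₂.idx IReg.state 0 = s := by simp (disch := decide) [f₂.idx, hs₁]
  have f₁₂ := f₁.seq f₂
  rw [hmax₁, firstMaximizer_eq_iSup s fun a => 𝓜.actionValue x I ⟨s, a⟩,
    f₁.real RReg.value (by decide), f₁.real RReg.threshold (by decide), hv, hthreshold,
    ← truncatedValue] at hnew₂
  refine (raiseValue_spec hsn hs₂).seq (q₂ := 0) (k₂ := 1) fun σ₃ f₃ ⟨hv₃, hπ₃, hΔ₃, hother₃⟩ =>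
    Spec.block ?_ ?_
  · simp [StaysInside, Instr.cells, 𝓜.Atot_pos]
  rw [hnew₂, f₁₂.real RReg.value (by decide), hv,
    ← 𝓜.iteration_v 𝓜.firstMaximizer x α M ω ℓ, ← hJ] at hv₃
  refine ⟨?_, ?_, ⟨?_, ?_, ?_⟩, fun i hi => ?_⟩
  · simp (disch := decide) [f₃.idx, hs₂]
  · simp (disch := decide) [f₃.idx, f₂.idx, hpair₁]
  · simpa using hv₃
  · rw [hJ, iteration_π]
    simp (disch := decide) only [hnew₂, f₂.idx, f₁₂.real, f₁.idx, hv, hbest₁, hπ] at hπ₃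
    simpa [apply_ite] using hπ₃
  · simp (disch := decide) [hΔ₃, hv₃, f₁₂.real, hv]
  · simpa (disch := decide) [f₁₂.real, f₁₂.idx] using hother₃ i hi

lemma updateStates_spec (hJ : J = 𝓜.iteration 𝓜.firstMaximizer x α M ω ℓ I)
    (hS : σ.idx IReg.numStates 0 = 𝓜.numStates)
    (hA : σ.idx IReg.numActions = toArray 𝓜.numActions)
    (hQ : ∀ p, σ.actionValueAt (𝓜.position p) = 𝓜.actionValue x I p)
    (hthreshold : σ.real RReg.threshold 0 = (1 - 𝓜.γ) * α)
    (hv : ∀ s : 𝓜.State, σ.real RReg.value s = I.v s)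
    (hπ : ∀ s : 𝓜.State, σ.idx IReg.policy s = I.π s) :
    Spec O 𝓜.Atot updateStates 0 (26 * 𝓜.Atot + 3) σ fun σ' =>
      ∀ s : 𝓜.State, σ'.real RReg.value s = J.v s ∧ σ'.idx IReg.policy s = J.π s ∧
        σ'.real RReg.increment s = J.v s - I.v s := by
  have hn := 𝓜.Atot_pos
  refine Spec.seq (q₁ := 0) (k₁ := 2) (q₂ := 0) (k₂ := 26 * 𝓜.Atot + 1)
    (Q₁ := fun σ' => σ'.idx IReg.state 0 = 0 ∧ σ'.idx IReg.pair 0 = 0)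
    (Spec.block (by simp [StaysInside, Instr.cells, hn]) (by simp)) fun σ₁ f₁ h₁ => ?_
  refine (stateLoop_spec 0 15 10 (fun k σ' => σ'.idx IReg.pair 0 = 𝓜.offset k ∧
      ∀ s : 𝓜.State, if (s : ℕ) < k then
        σ'.real RReg.value s = J.v s ∧ σ'.idx IReg.policy s = J.π s ∧
          σ'.real RReg.increment s = J.v s - I.v s
      else σ'.real RReg.value s = I.v s ∧ σ'.idx IReg.policy s = I.π s)
    ?_ h₁.1 ?_ fun s σ₂ f₂ hs h₂ => ?_).mono fun σ' _ h s => by simpa [s.2] using h.2 s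
  · simp (disch := decide) [f₁.idx, hS]
  · simp (disch := decide) [h₁.2, offset_zero, f₁.real, f₁.idx, hv, hπ]
  · have h₂s := h₂.2 s
    rw [if_neg (lt_irrefl _)] at h₂s
    refine (updateState_spec hJ ?_ hs h₂.1 (fun a => ?_) ?_ h₂s.1 h₂s.2).mono
      (fun σ₃ _ ⟨hs₃, hpair₃, hself, hother⟩ => ⟨hs₃, hpair₃, fun s' => ?_⟩)
      (Nat.zero_le _) le_rfl
    · simp (disch := decide) [f₂.idx, f₁.idx, hA]
    · rw [f₂.actionValueAt_eq (by decide), f₁.actionValueAt_eq (by decide), ← position_eq, hQ]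
    · simp (disch := decide) [f₂.real, f₁.real, hthreshold]
    · rcases eq_or_ne s' s with rfl | hne
      · simpa using hself
      · have hne' : (s' : ℕ) ≠ s := fun h => hne (Fin.ext h)
        obtain ⟨hv', hπ', hΔ'⟩ := hother s' hne'
        rw [hv', hπ', hΔ']
        have hlt : (s' : ℕ) < s + 1 ↔ (s' : ℕ) < s := by omega
        simpa only [hlt] using h₂.2 s'

end DMDP

/-! ### Sampling -/

namespace DMDP

open RealRAM

variable {𝓜 : DMDP} {ω : 𝓜.Tape} {M m : ℕ} {u : 𝓜.State → ℝ} {g : 𝓜.Pair → ℝ} {σ : Config}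

lemma oracle_apply (ω : 𝓜.Tape) (p : 𝓜.Pair) (j : ℕ) : 𝓜.oracle ω p.1 p.2 j = ω p j := by
  have h : ∃ hs : (p.1 : ℕ) < 𝓜.numStates, (p.2 : ℕ) < 𝓜.numActions ⟨p.1, hs⟩ :=
    ⟨p.1.2, p.2.2⟩
  rw [oracle, dif_pos h]

lemma pair_ext {p p' : 𝓜.Pair} (h₁ : (p.1 : ℕ) = p'.1) (h₂ : (p.2 : ℕ) = p'.2) : p = p' := by
  obtain ⟨s, a⟩ := p
  obtain ⟨s', a'⟩ := p'
  obtain rfl : s = s' := Fin.ext h₁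
  exact congrArg _ (Fin.ext h₂)

lemma sampleLoop_spec {p : 𝓜.Pair} (hM : σ.idx IReg.sampleCount 0 = M)
    (hs : σ.idx IReg.state 0 = p.1) (ha : σ.idx IReg.action 0 = p.2)
    (hsample : σ.idx IReg.sample 0 = 0) (hsum : σ.real RReg.sampleSum 0 = 0)
    (hu : ∀ s : 𝓜.State, σ.real RReg.increment s = u s) (hm : σ.asked p.1 p.2 = m) :
    Spec (𝓜.oracle ω) 𝓜.Atot sampleLoop M (4 * M + 1) σ fun σ' =>
      σ'.real RReg.sampleSum 0 = ∑ j ∈ Finset.range M, u (ω p (m + j)) ∧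
      ∀ b i, σ'.asked b i = if b = p.1 ∧ i = p.2 then m + M else σ.asked b i := by
  have hn := 𝓜.Atot_pos
  refine (Spec.loop (fun _ => 1) (fun _ => 3) M (fun k σ' => σ'.idx IReg.sample 0 = k ∧
    σ'.real RReg.sampleSum 0 = ∑ j ∈ Finset.range k, u (ω p (m + j)) ∧
    ∀ b i, σ'.asked b i = if b = p.1 ∧ i = p.2 then m + k else σ.asked b i)
    ⟨hsample, by simp [hsum], fun b i => ?_⟩ ?_ ?_ ?_).mono
    (fun _ _ h => h.2) (by simp) (by simp; omega)
  · split_ifs with h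
    · rw [h.1, h.2, hm, add_zero]
    · rfl
  · simp [hn]
  · intro k _ σ' hf hi
    simp (disch := decide) [hi, hf.idx, hM]
  · intro k _ σ' hf ⟨hk', hsum', hasked⟩
    have hs' : σ'.idx IReg.state 0 = p.1 := by simp (disch := decide) [hf.idx, hs]
    have ha' : σ'.idx IReg.action 0 = p.2 := by simp (disch := decide) [hf.idx, ha]
    have hu' := hf.real RReg.increment (by decide)
    refine Spec.block ?_ ⟨by simp [hk'], ?_, fun b i => ?_⟩
    · simp [StaysInside, Instr.cells, Finset.union_subset_iff, hn, hs', ha', oracle_apply,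
        𝓜.state_lt_Atot]
    · simp [ROp.eval, hs', ha', hasked, oracle_apply, hsum', hu', hu, Finset.sum_range_succ]
    · simp only [run_cons, run_nil, step_iSucc_asked, step_rOp_asked, step_query_asked,
        iVal_scalar, hs', ha', hasked]
      split_ifs <;> simp_all [add_assoc]

lemma samplePair_spec {p : 𝓜.Pair} (hM : σ.idx IReg.sampleCount 0 = M)
    (hM' : σ.real RReg.counter 0 = M) (hs : σ.idx IReg.state 0 = p.1)
    (ha : σ.idx IReg.action 0 = p.2) (hpair : σ.idx IReg.pair 0 = 𝓜.position p)
    (hu : ∀ s : 𝓜.State, σ.real RReg.increment s = u s) (hm : σ.asked p.1 p.2 = m) :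
    Spec (𝓜.oracle ω) 𝓜.Atot samplePair M (4 * M + 7) σ fun σ' =>
      σ'.idx IReg.action 0 = p.2 + 1 ∧ σ'.idx IReg.pair 0 = 𝓜.position p + 1 ∧
      (∀ i, σ'.real RReg.estimate i = if i = 𝓜.position p then
        σ.real RReg.estimate i + (1 / (M : ℝ)) * ∑ j ∈ Finset.range M, u (ω p (m + j))
        else σ.real RReg.estimate i) ∧
      ∀ b i, σ'.asked b i = if b = p.1 ∧ i = p.2 then m + M else σ.asked b i := by
  have hn := 𝓜.Atot_pos
  refine Spec.seq (q₁ := 0) (k₁ := 2) (q₂ := M) (k₂ := 4 * M + 5)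
    (Q₁ := fun σ' => σ'.real RReg.sampleSum 0 = 0 ∧ σ'.idx IReg.sample 0 = 0)
    (Spec.block (by simp [StaysInside, Instr.cells, hn]) (by simp)) fun σ₁ f₁ h₁ => ?_
  refine (sampleLoop_spec (p := p) (M := M) (m := m) (u := u) ?_ ?_ ?_ h₁.2 h₁.1 ?_ ?_).seq
    (q₂ := 0) (k₂ := 4) fun σ₂ f₂ ⟨hsum, hasked⟩ => ?_
  · simp (disch := decide) [f₁.idx, hM]
  · simp (disch := decide) [f₁.idx, hs]
  · simp (disch := decide) [f₁.idx, ha]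
  · simp (disch := decide) [f₁.real, hu]
  · rw [f₁.asked rfl, hm]
  have hpair₂ : σ₂.idx IReg.pair 0 = 𝓜.position p := by
    simp (disch := decide) [f₂.idx, f₁.idx, hpair]
  refine Spec.block ?_ ⟨?_, by simp [hpair₂], fun i => ?_, fun b i => ?_⟩
  · simp [StaysInside, Instr.cells, Finset.union_subset_iff, hn, hpair₂, position_lt]
  · simp (disch := decide) [f₂.idx, f₁.idx, ha]
  · have hestimate := (f₁.seq f₂).real RReg.estimate (by decide)
    have hM₂ : σ₂.real RReg.counter 0 = M := by simp (disch := decide) [f₂.real, f₁.real, hM']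
    by_cases hi : i = 𝓜.position p <;>
      simp [hi, hpair₂, hestimate, hM₂, hsum, ROp.eval, div_eq_inv_mul]
  · simp only [run_cons, run_nil, step_iSucc_asked, step_rOp_asked, hasked, f₁.asked rfl]

/-- The first `P` pairs have been processed in an update of the estimates `g` by `M` samples each,
taken at `u`, when `m` samples had been taken before. -/
def EstimatedUpTo (ω : 𝓜.Tape) (M m : ℕ) (u : 𝓜.State → ℝ) (g : 𝓜.Pair → ℝ) (P : ℕ)
    (σ : Config) : Prop :=
  ∀ p, (σ.real RReg.estimate (𝓜.position p) = if 𝓜.position p < P then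
      g p + (1 / (M : ℝ)) * ∑ j ∈ Finset.range M, u (ω p (m + j)) else g p) ∧
    σ.asked p.1 p.2 = if 𝓜.position p < P then m + M else m

lemma samplePair_spec_estimatedUpTo {p : 𝓜.Pair} (hM : σ.idx IReg.sampleCount 0 = M)
    (hM' : σ.real RReg.counter 0 = M) (hs : σ.idx IReg.state 0 = p.1)
    (ha : σ.idx IReg.action 0 = p.2) (hpair : σ.idx IReg.pair 0 = 𝓜.position p)
    (hu : ∀ s : 𝓜.State, σ.real RReg.increment s = u s)
    (hσ : 𝓜.EstimatedUpTo ω M m u g (𝓜.position p) σ) :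
    Spec (𝓜.oracle ω) 𝓜.Atot samplePair M (4 * M + 7) σ fun σ' =>
      σ'.idx IReg.action 0 = p.2 + 1 ∧ σ'.idx IReg.pair 0 = 𝓜.position p + 1 ∧
      𝓜.EstimatedUpTo ω M m u g (𝓜.position p + 1) σ' := by
  have hm : σ.asked p.1 p.2 = m := by simpa using (hσ p).2
  refine (samplePair_spec hM hM' hs ha hpair hu hm).mono
    fun σ' _ ⟨haction, hpair', hestimate, hasked⟩ => ⟨haction, hpair', fun p' => ?_⟩
  rw [hestimate, hasked, (hσ p').1, (hσ p').2]
  rcases eq_or_ne p' p with rfl | hp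
  · simp
  · have hposition : 𝓜.position p' ≠ 𝓜.position p := fun h => hp (𝓜.position_injective h)
    have hval : ¬ ((p'.1 : ℕ) = p.1 ∧ (p'.2 : ℕ) = p.2) := fun h => hp (pair_ext h.1 h.2)
    have hlt : 𝓜.position p' < 𝓜.position p + 1 ↔ 𝓜.position p' < 𝓜.position p := by omega
    simp only [hposition, hval, hlt, if_false, and_self]

lemma sampleState_spec {s : 𝓜.State} (hM : σ.idx IReg.sampleCount 0 = M)
    (hM' : σ.real RReg.counter 0 = M) (hA : σ.idx IReg.numActions = toArray 𝓜.numActions)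
    (hs : σ.idx IReg.state 0 = s) (hpair : σ.idx IReg.pair 0 = 𝓜.offset s)
    (hu : ∀ s : 𝓜.State, σ.real RReg.increment s = u s)
    (hσ : 𝓜.EstimatedUpTo ω M m u g (𝓜.offset s) σ) :
    Spec (𝓜.oracle ω) 𝓜.Atot sampleState (M * 𝓜.numActions s)
      (3 + (4 * M + 8) * 𝓜.numActions s) σ fun σ' =>
        σ'.idx IReg.state 0 = s + 1 ∧ σ'.idx IReg.pair 0 = 𝓜.offset (s + 1) ∧
        𝓜.EstimatedUpTo ω M m u g (𝓜.offset (s + 1)) σ' := by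
  have hn := 𝓜.Atot_pos
  refine Spec.seq (q₁ := 0) (k₁ := 1) (q₂ := M * 𝓜.numActions s)
    (k₂ := 2 + (4 * M + 8) * 𝓜.numActions s) (Q₁ := fun σ' => σ'.idx IReg.action 0 = 0)
    (Spec.block (by simp [StaysInside, Instr.cells, hn]) (by simp)) fun σ₁ f₁ h₁ => ?_
  refine Spec.seq (k₁ := (4 * M + 8) * 𝓜.numActions s + 1) (q₂ := 0) (k₂ := 1)
    (actionLoop_spec (s := s) M (4 * M + 7) (fun j σ' => σ'.idx IReg.pair 0 = 𝓜.offset s + j ∧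
        𝓜.EstimatedUpTo ω M m u g (𝓜.offset s + j) σ') ?_ ?_ h₁ ⟨?_, fun p => ?_⟩
      fun a σ₂ f₂ haction ⟨hpair₂, hσ₂⟩ => ?_)
    fun σ₂ f₂ h₂ => Spec.block ?_ ⟨?_, ?_, fun p => ?_⟩
  · simp (disch := decide) [f₁.idx, hA]
  · simp (disch := decide) [f₁.idx, hs]
  · simp (disch := decide) [f₁.idx, hpair]
  · rw [f₁.real _ (by decide), f₁.asked rfl]
    exact hσ p
  · rw [← position_eq] at hpair₂ hσ₂
    rw [← add_assoc, ← position_eq]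
    refine samplePair_spec_estimatedUpTo ?_ ?_ ?_ haction hpair₂ ?_ hσ₂
    · simp (disch := decide) [f₂.idx, f₁.idx, hM]
    · simp (disch := decide) [f₂.real, f₁.real, hM']
    · simp (disch := decide) [f₂.idx, f₁.idx, hs]
    · simp (disch := decide) [f₂.real, f₁.real, hu]
  · simp [StaysInside, Instr.cells, hn]
  · simp (disch := decide) [f₂.idx, f₁.idx, hs]
  · simpa [offset_succ] using h₂.1
  · rw [offset_succ]
    exact h₂.2 p

lemma updateEstimates_spec (hS : σ.idx IReg.numStates 0 = 𝓜.numStates)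
    (hA : σ.idx IReg.numActions = toArray 𝓜.numActions) (hM : σ.idx IReg.sampleCount 0 = M)
    (hM' : σ.real RReg.counter 0 = M) (hu : ∀ s : 𝓜.State, σ.real RReg.increment s = u s)
    (hg : ∀ p, σ.real RReg.estimate (𝓜.position p) = g p)
    (hm : ∀ p : 𝓜.Pair, σ.asked p.1 p.2 = m) :
    Spec (𝓜.oracle ω) 𝓜.Atot updateEstimates (M * 𝓜.Atot) ((4 * M + 12) * 𝓜.Atot + 3) σ
      fun σ' => ∀ p, σ'.real RReg.estimate (𝓜.position p) =
          g p + (1 / (M : ℝ)) * ∑ j ∈ Finset.range M, u (ω p (m + j)) ∧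
        σ'.asked p.1 p.2 = m + M := by
  have hn := 𝓜.Atot_pos
  refine Spec.seq (q₁ := 0) (k₁ := 2) (q₂ := M * 𝓜.Atot) (k₂ := (4 * M + 12) * 𝓜.Atot + 1)
    (Q₁ := fun σ' => σ'.idx IReg.state 0 = 0 ∧ σ'.idx IReg.pair 0 = 0)
    (Spec.block (by simp [StaysInside, Instr.cells, hn]) (by simp)) fun σ₁ f₁ h₁ => ?_
  refine (stateLoop_spec M 3 (4 * M + 8) (fun k σ' => σ'.idx IReg.pair 0 = 𝓜.offset k ∧
      𝓜.EstimatedUpTo ω M m u g (𝓜.offset k) σ') ?_ h₁.1 ⟨?_, fun p => ?_⟩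
    fun s σ₂ f₂ hs ⟨hpair, hσ₂⟩ => sampleState_spec ?_ ?_ ?_ hs hpair ?_ hσ₂).mono
      (fun σ' _ h p => ?_) le_rfl (le_of_eq (by ring))
  · simp (disch := decide) [f₁.idx, hS]
  · rw [h₁.2, offset_zero]
  · rw [f₁.real _ (by decide), f₁.asked rfl]
    simp [offset_zero, hg, hm]
  · simp (disch := decide) [f₂.idx, f₁.idx, hM]
  · simp (disch := decide) [f₂.real, f₁.real, hM']
  · simp (disch := decide) [f₂.idx, f₁.idx, hA]
  · simp (disch := decide) [f₂.real, f₁.real, hu]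
  · simpa [offset_numStates, position_lt] using h.2 p

end DMDP

/-! ### Correctness of the program -/

namespace RealRAM

variable {O : ℕ → ℕ → ℕ → ℕ} {n : ℕ} {σ : Config}

lemma computeThreshold_spec (hn : 0 < n) {γ α : ℝ} (hγ : σ.real RReg.discount 0 = γ)
    (hα : σ.real RReg.initialError 0 = α) :
    Spec O n computeThreshold 0 7 σ fun σ' =>
      σ'.real RReg.one 0 = 1 ∧ σ'.real RReg.threshold 0 = (1 - γ) * α ∧
        σ'.real RReg.laterShift 0 = (1 - γ) * α / 8 ∧
        σ'.real RReg.target 0 = Real.log 8 * (1 - γ)⁻¹ := by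
  refine Spec.block ?_ ?_
  · simp [StaysInside, Instr.cells, Finset.union_subset_iff, hn]
  · simp [ROp.eval, hγ, hα, div_eq_mul_inv]

lemma computeSampleTarget_spec (hn : 0 < n) {A L δ : ℝ} (hA : σ.real RReg.numPairs 0 = A)
    (hL : σ.real RReg.iterCount 0 = L) (hδ : σ.real RReg.confidence 0 = δ) :
    Spec O n computeSampleTarget 0 8 σ fun σ' =>
      σ'.real RReg.counter 0 = 0 ∧
        σ'.real RReg.target 0 = L * 2 ^ 8 * Real.log (2 * A / δ) := by
  refine Spec.block ?_ ?_
  · simp [StaysInside, Instr.cells, Finset.union_subset_iff, hn]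
  · norm_num [ROp.eval, hA, hL, hδ]

lemma computeIterCount_spec (hn : 0 < n) {γ α : ℝ} (hγ : σ.real RReg.discount 0 = γ)
    (hα : σ.real RReg.initialError 0 = α) (hcounter : σ.real RReg.counter 0 = 0)
    (h0 : σ.idx IReg.iterCount 0 = 0) :
    Spec O n computeIterCount 0 (3 * ⌈Real.log 8 * (1 - γ)⁻¹⌉₊ + 9) σ fun σ' =>
      σ'.real RReg.one 0 = 1 ∧ σ'.real RReg.threshold 0 = (1 - γ) * α ∧
        σ'.real RReg.laterShift 0 = (1 - γ) * α / 8 ∧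
        σ'.idx IReg.iterCount 0 = ⌈Real.log 8 * (1 - γ)⁻¹⌉₊ ∧
        σ'.real RReg.iterCount 0 = ⌈Real.log 8 * (1 - γ)⁻¹⌉₊ := by
  refine (computeThreshold_spec hn hγ hα).seq (q₂ := 0)
    (k₂ := 3 * ⌈Real.log 8 * (1 - γ)⁻¹⌉₊ + 2) fun σ₁ f₁ ⟨hone, hthreshold, hshift, htarget⟩ => ?_
  refine (ceilLoop_spec hn (by decide) hone ?_ htarget ?_).seq (q₂ := 0) (k₂ := 1)
    fun σ₂ f₂ ⟨hL, hL'⟩ => Spec.block ?_ ?_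
  · rw [f₁.real _ (by decide), hcounter]
  · rw [f₁.idx _ (by decide), h0]
  · simp [StaysInside, Instr.cells, Finset.union_subset_iff, hn]
  · simp (disch := decide) [f₂.real, hone, hthreshold, hshift, hL, hL']

lemma computeSampleCount_spec (hn : 0 < n) {A L δ : ℝ} (hone : σ.real RReg.one 0 = 1)
    (hA : σ.real RReg.numPairs 0 = A) (hL : σ.real RReg.iterCount 0 = L)
    (hδ : σ.real RReg.confidence 0 = δ) (h0 : σ.idx IReg.sampleCount 0 = 0) :
    Spec O n computeSampleCount 0 (3 * ⌈L * 2 ^ 8 * Real.log (2 * A / δ)⌉₊ + 9) σ fun σ' =>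
      σ'.idx IReg.sampleCount 0 = ⌈L * 2 ^ 8 * Real.log (2 * A / δ)⌉₊ ∧
        σ'.real RReg.counter 0 = ⌈L * 2 ^ 8 * Real.log (2 * A / δ)⌉₊ := by
  refine (computeSampleTarget_spec hn hA hL hδ).seq (q₂ := 0)
    (k₂ := 3 * ⌈L * 2 ^ 8 * Real.log (2 * A / δ)⌉₊ + 1) fun σ₁ f₁ ⟨hcounter, htarget⟩ =>
      ceilLoop_spec hn (by decide) ?_ hcounter htarget ?_
  · rw [f₁.real _ (by decide), hone]
  · rw [f₁.idx _ (by decide), h0]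

end RealRAM

namespace DMDP

open RealRAM

variable {𝓜 : DMDP} {ω : 𝓜.Tape} {x : 𝓜.Pair → ℝ} {α δ : ℝ} {M : ℕ} {σ : Config}

/-- The memory holds the constants that the iterations use. -/
structure HoldsConstants (𝓜 : DMDP) (x : 𝓜.Pair → ℝ) (α : ℝ) (M : ℕ) (σ : Config) : Prop where
  numStates : σ.idx IReg.numStates 0 = 𝓜.numStates
  numActions : σ.idx IReg.numActions = toArray 𝓜.numActions
  iterCount : σ.idx IReg.iterCount 0 = 𝓜.iterCount
  sampleCount : σ.idx IReg.sampleCount 0 = M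
  discount : σ.real RReg.discount 0 = 𝓜.γ
  reward : σ.real RReg.reward = 𝓜.pairArray fun p => 𝓜.reward p.1 p.2
  offset : σ.real RReg.offset = 𝓜.pairArray x
  counter : σ.real RReg.counter 0 = M
  threshold : σ.real RReg.threshold 0 = (1 - 𝓜.γ) * α
  laterShift : σ.real RReg.laterShift 0 = (1 - 𝓜.γ) * α / 8

lemma HoldsConstants.of_frame {p : Prog} {σ' : Config} (h : 𝓜.HoldsConstants x α M σ)
    (hf : Frame p σ σ')
    (hI : Disjoint {IReg.numStates, IReg.numActions, IReg.iterCount, IReg.sampleCount} p.iWrites :=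
      by decide)
    (hR : Disjoint {RReg.discount, RReg.reward, RReg.offset, RReg.counter, RReg.threshold,
      RReg.laterShift} p.rWrites := by decide) :
    𝓜.HoldsConstants x α M σ' := by
  simp only [Finset.disjoint_insert_left, Finset.disjoint_singleton_left] at hI hR
  obtain ⟨hS, hA, hL, hM⟩ := hI
  obtain ⟨hγ, hr, hx, hM', hα, hshift⟩ := hR
  constructor
  · rw [hf.idx _ hS, h.numStates]
  · rw [hf.idx _ hA, h.numActions]
  · rw [hf.idx _ hL, h.iterCount]
  · rw [hf.idx _ hM, h.sampleCount]
  · rw [hf.real _ hγ, h.discount]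
  · rw [hf.real _ hr, h.reward]
  · rw [hf.real _ hx, h.offset]
  · rw [hf.real _ hM', h.counter]
  · rw [hf.real _ hα, h.threshold]
  · rw [hf.real _ hshift, h.laterShift]

/-- The memory holds the variables `I` of the algorithm, and every pair has been sampled `m`
times. -/
structure HoldsIterate (𝓜 : DMDP) (I : 𝓜.Iterate) (m : ℕ) (σ : Config) : Prop where
  v : ∀ s : 𝓜.State, σ.real RReg.value s = I.v s
  π : ∀ s : 𝓜.State, σ.idx IReg.policy s = I.π s
  g : ∀ p, σ.real RReg.estimate (𝓜.position p) = I.g p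
  gHat : ∀ p, σ.real RReg.estimate (𝓜.position p) - σ.real RReg.shift 0 = I.gHat p
  asked : ∀ p : 𝓜.Pair, σ.asked p.1 p.2 = m

lemma HoldsIterate.charge {I : 𝓜.Iterate} {m : ℕ} (h : 𝓜.HoldsIterate I m σ)
    (cells : Finset Cell) : 𝓜.HoldsIterate I m (σ.charge cells) :=
  ⟨h.v, h.π, h.g, h.gHat, h.asked⟩

lemma HoldsIterate.actionValueAt_position {I : 𝓜.Iterate} {m : ℕ} (h : 𝓜.HoldsIterate I m σ)
    (hc : 𝓜.HoldsConstants x α M σ) (p : 𝓜.Pair) :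
    σ.actionValueAt (𝓜.position p) = 𝓜.actionValue x I p := by
  rw [Config.actionValueAt, h.gHat, hc.reward, hc.offset, hc.discount, pairArray_position,
    pairArray_position, actionValue]

lemma iterate_spec {ℓ : ℕ} {I : 𝓜.Iterate} (hM : 0 < M) (hc : 𝓜.HoldsConstants x α M σ)
    (hI : 𝓜.HoldsIterate I (ℓ * M) σ) (hℓ : σ.idx IReg.iteration 0 = ℓ) :
    Spec (𝓜.oracle ω) 𝓜.Atot iterate (M * 𝓜.Atot) (50 * (M * 𝓜.Atot)) σ fun σ' =>
      σ'.idx IReg.iteration 0 = ℓ + 1 ∧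
        𝓜.HoldsIterate (𝓜.iteration 𝓜.firstMaximizer x α M ω ℓ I) ((ℓ + 1) * M) σ' := by
  have hn := 𝓜.Atot_pos
  set J := 𝓜.iteration 𝓜.firstMaximizer x α M ω ℓ I with hJ
  have hbudget : 26 * 𝓜.Atot + 3 + ((4 * M + 12) * 𝓜.Atot + 5) ≤ 50 * (M * 𝓜.Atot) := by
    have : 𝓜.Atot ≤ M * 𝓜.Atot := Nat.le_mul_of_pos_left _ hM
    linarith
  refine Spec.seq (q₁ := 0) (k₁ := 26 * 𝓜.Atot + 3) (q₂ := M * 𝓜.Atot)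
    (k₂ := (4 * M + 12) * 𝓜.Atot + 5) (updateStates_spec hJ hc.numStates hc.numActions
      (hI.actionValueAt_position hc) hc.threshold hI.v hI.π) (fun σ₁ f₁ h₁ => ?_)
    (by omega) hbudget
  have hc₁ := hc.of_frame f₁
  refine (updateEstimates_spec (u := J.v - I.v) (g := I.g) (m := ℓ * M) hc₁.numStates
    hc₁.numActions hc₁.sampleCount hc₁.counter (fun s => (h₁ s).2.2) (fun p => ?_)
    fun p => ?_).seq (q₂ := 0) (k₂ := 2) fun σ₂ f₂ h₂ => Spec.block ?_ ?_
  · rw [f₁.real _ (by decide), hI.g]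
  · rw [f₁.asked rfl, hI.asked]
  · simp [StaysInside, Instr.cells, Finset.union_subset_iff, hn]
  have hc₂ := hc₁.of_frame f₂
  have hg (p : 𝓜.Pair) : σ₂.real RReg.estimate (𝓜.position p) = J.g p := by
    rw [(h₂ p).1, hJ, iteration_g]
  refine ⟨?_, fun s => ?_, fun s => ?_, fun p => ?_, fun p => ?_, fun p => ?_⟩
  · simp (disch := decide) [f₂.idx, f₁.idx, hℓ]
  · simp (disch := decide) [f₂.real, h₁]
  · simp (disch := decide) [f₂.idx, h₁]
  · simp [hg]
  · simp [hg, hc₂.laterShift, hJ, iteration_gHat]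
  · rw [add_mul, one_mul]; exact (h₂ p).2

variable {v₀ : 𝓜.State → ℝ} {π₀ : 𝓜.Policy}

lemma setup_spec {O : ℕ → ℕ → ℕ → ℕ} :
    Spec O 𝓜.Atot setup 0 (3 * 𝓜.iterCount + 8 * 𝓜.Atot + 3 * 𝓜.sampleCount δ + 20)
      (𝓜.startConfig v₀ π₀ x α δ) (𝓜.HoldsConstants x α (𝓜.sampleCount δ)) := by
  have hn := 𝓜.Atot_pos
  have hfirst : Spec O 𝓜.Atot computeIterCount 0 (3 * 𝓜.iterCount + 9)
      (𝓜.startConfig v₀ π₀ x α δ) _ :=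
    computeIterCount_spec (γ := 𝓜.γ) (α := α) hn rfl rfl rfl rfl
  refine hfirst.seq (q₂ := 0) (k₂ := 8 * 𝓜.Atot + 3 * 𝓜.sampleCount δ + 11)
    fun σ₁ f₁ ⟨hone, hthreshold, hshift, hL, hL'⟩ => ?_
  refine (countPairs_spec ?_ ?_ ?_ hone ?_).seq (q₂ := 0) (k₂ := 3 * 𝓜.sampleCount δ + 9)
    fun σ₂ f₂ hA => ?_
  · rw [f₁.idx _ (by decide)]; rfl
  · rw [f₁.idx _ (by decide)]; rfl
  · rw [f₁.idx _ (by decide)]; rfl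
  · rw [f₁.real _ (by decide)]; rfl
  refine (computeSampleCount_spec (δ := δ) (L := 𝓜.iterCount) hn ?_ hA ?_ ?_ ?_).mono
    (fun σ₃ f₃ ⟨hM, hM'⟩ => ?_) le_rfl le_rfl
  · rw [f₂.real _ (by decide), hone]
  · rw [f₂.real _ (by decide), hL']; rfl
  · simp (disch := decide) only [f₂.real, f₁.real]; rfl
  · simp (disch := decide) only [f₂.idx, f₁.idx]; rfl
  refine ⟨?_, ?_, ?_, hM, ?_, ?_, ?_, hM', ?_, ?_⟩
  · simp (disch := decide) only [f₃.idx, f₂.idx, f₁.idx]; rfl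
  · simp (disch := decide) only [f₃.idx, f₂.idx, f₁.idx]; rfl
  · simp (disch := decide) only [f₃.idx, f₂.idx, hL]; rfl
  · simp (disch := decide) only [f₃.real, f₂.real, f₁.real]; rfl
  · simp (disch := decide) only [f₃.real, f₂.real, f₁.real]; rfl
  · simp (disch := decide) only [f₃.real, f₂.real, f₁.real]; rfl
  · simp (disch := decide) only [f₃.real, f₂.real, hthreshold]
  · simp (disch := decide) only [f₃.real, f₂.real, hshift]

lemma loop_iterate_spec (hM : 0 < M)
    (hc : 𝓜.HoldsConstants x α M σ) (hℓ : σ.idx IReg.iteration 0 = 0)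
    (hI : 𝓜.HoldsIterate (𝓜.iterates 𝓜.firstMaximizer v₀ π₀ x α M ω 0) 0 σ) :
    Spec (𝓜.oracle ω) 𝓜.Atot
      (.loop (.iLt (.scalar IReg.iteration) (.scalar IReg.iterCount)) iterate)
      (𝓜.Atot * M * 𝓜.iterCount) (51 * (𝓜.Atot * M * 𝓜.iterCount) + 1) σ
      (𝓜.HoldsIterate (𝓜.iterates 𝓜.firstMaximizer v₀ π₀ x α M ω 𝓜.iterCount)
        (𝓜.iterCount * M)) := by
  have hn := 𝓜.Atot_pos
  refine (Spec.loop (fun _ => M * 𝓜.Atot) (fun _ => 50 * (M * 𝓜.Atot)) 𝓜.iterCount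
    (fun ℓ σ' => σ'.idx IReg.iteration 0 = ℓ ∧
      𝓜.HoldsIterate (𝓜.iterates 𝓜.firstMaximizer v₀ π₀ x α M ω ℓ) (ℓ * M) σ')
    ⟨hℓ, by rwa [zero_mul]⟩ (fun σ' _ => by simp [hn]) ?_ ?_
    fun ℓ σ' cells h => ⟨h.1, h.2.charge cells⟩).mono (fun _ _ h => h.2) ?_ ?_
  · intro ℓ _ σ' hf hi
    simp [hi.1, (hc.of_frame hf).iterCount]
  · intro ℓ _ σ' hf hi
    exact iterate_spec hM (hc.of_frame hf) hi.2 hi.1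
  · simp [mul_comm]
  · have : 𝓜.iterCount ≤ 𝓜.Atot * M * 𝓜.iterCount := Nat.le_mul_of_pos_left _ (by positivity)
    simp only [Finset.sum_const, Finset.card_range, smul_eq_mul]
    linarith

lemma program_spec (h0 : 0 < δ) (h1 : δ < 1) :
    ∃ σ : Config, Exec (𝓜.oracle ω) program (𝓜.startConfig v₀ π₀ x α δ) σ ∧
      𝓜.IsOutput σ (𝓜.truncatedVRVI 𝓜.firstMaximizer v₀ π₀ x α δ ω).1
        (𝓜.truncatedVRVI 𝓜.firstMaximizer v₀ π₀ x α δ ω).2 ∧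
      σ.queries ≤ 𝓜.Atot * 𝓜.sampleCount δ * 𝓜.iterCount ∧
      σ.time ≤ 100 * (𝓜.Atot * 𝓜.sampleCount δ * 𝓜.iterCount) ∧
      σ.touched.card ≤ 100 * 𝓜.Atot := by
  have hn := 𝓜.Atot_pos
  have hM := 𝓜.sampleCount_pos h0 h1
  have hL := 𝓜.iterCount_pos
  set K := 𝓜.Atot * 𝓜.sampleCount δ * 𝓜.iterCount with hK
  have hAK : 𝓜.Atot ≤ K := by rw [hK, mul_assoc]; exact Nat.le_mul_of_pos_right _ (by positivity)
  have hMK : 𝓜.sampleCount δ ≤ K := by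
    rw [hK, mul_right_comm]; exact Nat.le_mul_of_pos_left _ (by positivity)
  have hLK : 𝓜.iterCount ≤ K := Nat.le_mul_of_pos_left _ (by positivity)
  obtain ⟨σ, hexec, hbudget, hI⟩ : Spec (𝓜.oracle ω) 𝓜.Atot program K (100 * K)
      (𝓜.startConfig v₀ π₀ x α δ) (𝓜.HoldsIterate (𝓜.iterates 𝓜.firstMaximizer v₀ π₀ x α
        (𝓜.sampleCount δ) ω 𝓜.iterCount) (𝓜.iterCount * 𝓜.sampleCount δ)) := by
    refine setup_spec.seq (q₂ := K) (k₂ := 51 * K + 1) fun σ₁ f₁ hc =>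
      loop_iterate_spec hM hc ?_ ⟨fun s => ?_, fun s => ?_, fun p => ?_, fun p => ?_, fun p => ?_⟩
    · rw [f₁.idx _ (by decide)]; rfl
    · rw [f₁.real _ (by decide)]; exact toArray_of_lt v₀ s.2
    · rw [f₁.idx _ (by decide)]; exact toArray_of_lt (fun s => (π₀ s : ℕ)) s.2
    · rw [f₁.real _ (by decide)]; rfl
    · simp (disch := decide) only [f₁.real]; exact sub_zero 0
    · rw [f₁.asked rfl]; rfl
  refine ⟨σ, hexec, fun s => ⟨hI.v s, hI.π s⟩, ?_, ?_, ?_⟩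
  · exact hbudget.queries.trans_eq (zero_add _)
  · exact hbudget.time.trans_eq (zero_add _)
  · calc σ.touched.card ≤ (workspace 𝓜.Atot).card :=
          Finset.card_le_card (hbudget.touched (Finset.empty_subset _))
      _ ≤ 48 * 𝓜.Atot := card_workspace_le _
      _ ≤ 100 * 𝓜.Atot := by gcongr; norm_num

end DMDP

end

theorem corollary2p3 :
    -- accuracy
    (∀ (𝓜 : DMDP) (am : 𝓜.SelectionRule) (v₀ : 𝓜.State → ℝ) (π₀ : 𝓜.Policy)
        (x β : 𝓜.Pair → ℝ) (α δ : ℝ)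
        (Ω : Type*) [MeasurableSpace Ω] (μ : Measure Ω) [IsProbabilityMeasure μ]
        (X : 𝓜.Pair → ℕ → Ω → 𝓜.State),
      𝓜.IsArgmaxRule am →
      0 < δ → δ < 1 →
      (∀ p, 0 ≤ β p) →
      (∀ p, 𝓜.utility v₀ p - β p ≤ x p ∧ x p ≤ 𝓜.utility v₀ p) →
      IsUnderestimate α v₀ 𝓜.optimalValue →
      (∀ s, v₀ s ≤ 𝓜.policyOp π₀ v₀ s) →
      𝓜.IsGenerativeModel μ X →
      1 - δ ≤ μ.real {ω |
        let out := 𝓜.truncatedVRVI am v₀ π₀ x α δ (fun p j => X p j ω)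
        let v := out.1
        let π := out.2
        (∀ s, 0 ≤ 𝓜.optimalValue s - v s) ∧
        (∀ πs : 𝓜.Policy, 𝓜.IsOptimalPolicy πs →
          let ξ : 𝓜.State → ℝ := fun s => 𝓜.γ * ((1 - 𝓜.γ) / 4 * α + β ⟨s, πs s⟩)
          ∀ s, 𝓜.optimalValue s - v s ≤
            𝓜.γ ^ 𝓜.iterCount * α + ((1 - 𝓜.γ • 𝓜.policyMatrix πs)⁻¹.mulVec ξ) s) ∧
        (∀ s, v s ≤ 𝓜.policyOp π v s) ∧
        (β = 0 → ∀ s, 𝓜.optimalValue s - v s ≤ α / 2)}) ∧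
    -- implementation: one program and one constant for all inputs
    (∃ (prog : RealRAM.Prog) (C : ℕ), ∀ 𝓜 : DMDP, ∃ am : 𝓜.SelectionRule, 𝓜.IsArgmaxRule am ∧
      ∀ (v₀ : 𝓜.State → ℝ) (π₀ : 𝓜.Policy) (x : 𝓜.Pair → ℝ) (α δ : ℝ) (ω : 𝓜.Tape),
        0 ≤ α → 0 < δ → δ < 1 →
        ∃ σ : RealRAM.Config,
          RealRAM.Exec (𝓜.oracle ω) prog (𝓜.startConfig v₀ π₀ x α δ) σ ∧
          𝓜.IsOutput σ (𝓜.truncatedVRVI am v₀ π₀ x α δ ω).1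
            (𝓜.truncatedVRVI am v₀ π₀ x α δ ω).2 ∧
          σ.queries ≤ 𝓜.Atot * 𝓜.sampleCount δ * 𝓜.iterCount ∧
          σ.time ≤ C * (𝓜.Atot * 𝓜.sampleCount δ * 𝓜.iterCount) ∧
          σ.touched.card ≤ C * 𝓜.Atot) := by
  refine ⟨fun 𝓜 am v₀ π₀ x β α δ Ω _ μ _ X ham h0 h1 _ hx hv hπ hX => ?_,
    RealRAM.program, 100, fun 𝓜 => ⟨𝓜.firstMaximizer, 𝓜.isArgmaxRule_firstMaximizer,
      fun v₀ π₀ x α δ ω _ h0 h1 => DMDP.program_spec h0 h1⟩⟩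
  exact hX.le_measureReal_output ham h0 h1 hv.1 hx (fun s => (hv.2 s).1) hπ
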